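/- Let $R$ be a commutative noetherian ring with identity that is Cohen–Macaulay, and let $D$ be a dualizing module for $R$, that is, a finitely generated $R$-module of finite injective dimension such that the homothety map $R\to\operatorname{Hom}_R(D,D)$ is an isomorphism and $\operatorname{Ext}^i_R(D,D)=0$ for all $i\ge 1$. Let $\mathfrak p$ be a prime ideal of $R$ of height $h$, and let $E_R(R/\mathfrak p)$ be an injective hull of the $R$-module $R/\mathfrak p$. For an ideal $\mathfrak a$ of a commutative ring $A$ and an $A$-module $N$, let $\Gamma_{\mathfrak a}(N)=\{n\in N : \mathfrak a^m n=0 \text{ for some } m\ge 0\}$ and $H^i_{\mathfrak a}(N)=H^i(\Gamma_{\mathfrak a}(J))$, where $J$ is an injective resolution of $N$ over $A$; in particular $H^i_{\mathfrak a}(N)=0$ for $i<0$. Likewise $\operatorname{Tor}_k^R=0$ for $k<0$. Then for every $R$-module $M$ and every integer $k$ there are isomorphisms of $R$-modules $$\operatorname{Tor}_k^R(\operatorname{Hom}_R(D,E_R(R/\mathfrak p)),M)\;\cong\; H^{h-k}_{\mathfrak p}(M_{\mathfrak p})\;\cong\; H^{h-k}_{\mathfrak pR_{\mathfrak p}}(M_{\mathfrak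 p}),$$ where the middle module is the local cohomology of $M_{\mathfrak p}$ regarded as an $R$-module, and the last one is the local cohomology of $M_{\mathfrak p}$ regarded as an $R_{\mathfrak p}$-module. -/

import Mathlib

open CategoryTheory

universe u

namespace LocalCohomologyTor

/-- The noetherian local ring `A` is Cohen-Macaulay: its maximal ideal contains an `A`-regular
sequence of length `dim A` (that is, `depth A = dim A`, as `depth A ≤ dim A` always holds). -/
def IsLocalCohenMacaulay (A : Type u) [CommRing A] [IsLocalRing A] : Prop :=
  ∃ rs : List A, (∀ r ∈ rs, r ∈ IsLocalRing.maximalIdeal A) ∧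
    RingTheory.Sequence.IsRegular A rs ∧ (rs.length : WithBot ℕ∞) = ringKrullDim A

/-- A noetherian commutative ring all of whose localizations at primes are Cohen-Macaulay. -/
structure IsCohenMacaulay (R : Type u) [CommRing R] : Prop where
  noetherian : IsNoetherianRing R
  local_cohenMacaulay : ∀ (p : Ideal R) [p.IsPrime], IsLocalCohenMacaulay (Localization.AtPrime p)

/-- `C` is semidualizing: finitely generated, with bijective homothety map `R → Hom_R(C, C)`, and
`Ext^i_R(C, C) = 0` for all `i ≥ 1`. -/
structure IsSemidualizing (R : Type u) [CommRing R] (C : Type u) [AddCommGroup C] [Module R C] :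
    Prop where
  finite : Module.Finite R C
  homothety_bijective : Function.Bijective (LinearMap.lsmul R C)
  ext_vanishing : ∀ i : ℕ, 1 ≤ i →
    Subsingleton (Abelian.Ext (ModuleCat.of R C) (ModuleCat.of R C) i)

/-- A dualizing module is a semidualizing module of finite injective dimension. -/
structure IsDualizing (R : Type u) [CommRing R] (D : Type u) [AddCommGroup D] [Module R D] :
    Prop extends IsSemidualizing R D where
  finite_injectiveDimension : ∃ n : ℕ, HasInjectiveDimensionLE (ModuleCat.of R D) n

/-- `ι : N → E` is an injective hull of `N`: an embedding into an injective module whose image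
meets every nonzero submodule nontrivially. -/
structure IsInjectiveHull (R : Type u) [CommRing R] {N E : Type u} [AddCommGroup N] [Module R N]
    [AddCommGroup E] [Module R E] (ι : N →ₗ[R] E) : Prop where
  module_injective : Module.Injective R E
  injective : Function.Injective ι
  essential : ∀ U : Submodule R E, U ⊓ LinearMap.range ι = ⊥ → U = ⊥

section Torsion

variable {R : Type u} [CommRing R] (a : Ideal R)

/-- The `a`-torsion submodule `Γ_a(N)`: elements killed by some power of `a`. -/
def torsionSubmodule (N : Type u) [AddCommGroup N] [Module R N] : Submodule R N where
  carrier := {x | ∃ m : ℕ, ∀ r ∈ a ^ m, r • x = 0}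
  zero_mem' := ⟨0, fun r _ => smul_zero r⟩
  add_mem' := by
    rintro x y ⟨m, hm⟩ ⟨n, hn⟩
    refine ⟨m + n, fun r hr => ?_⟩
    rw [smul_add, hm r (Ideal.pow_le_pow_right (Nat.le_add_right m n) hr),
      hn r (Ideal.pow_le_pow_right (Nat.le_add_left n m) hr), add_zero]
  smul_mem' := by
    rintro c x ⟨m, hm⟩
    refine ⟨m, fun r hr => ?_⟩
    rw [smul_comm, hm r hr, smul_zero]

theorem map_mem_torsionSubmodule {N N' : Type u} [AddCommGroup N] [Module R N] [AddCommGroup N']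
    [Module R N'] (f : N →ₗ[R] N') (x : N) (hx : x ∈ torsionSubmodule a N) :
    f x ∈ torsionSubmodule a N' := by
  obtain ⟨m, hm⟩ := hx
  exact ⟨m, fun r hr => by rw [← map_smul, hm r hr, map_zero]⟩

/-- The `a`-torsion functor `Γ_a`. -/
def torsionFunctor : ModuleCat.{u} R ⥤ ModuleCat.{u} R where
  obj N := ModuleCat.of R (torsionSubmodule a N)
  map f := ModuleCat.ofHom (f.hom.restrict (map_mem_torsionSubmodule a f.hom))

instance : (torsionFunctor a).Additive where

end Torsion

/-- The local cohomology module `H^i_a(N) = H^i(Γ_a(J))`, with `J` an injective resolution of `N`;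
it is zero for `i < 0`. -/
noncomputable def localCohomologyModule {R : Type u} [CommRing R] (a : Ideal R) (i : ℤ)
    (N : ModuleCat.{u} R) : ModuleCat.{u} R :=
  match i with
  | Int.ofNat n => ((torsionFunctor a).rightDerived n).obj N
  | Int.negSucc _ => ModuleCat.of R PUnit

/-- The module `Tor_k^R(A, M)`; it is zero for `k < 0`. -/
noncomputable def torModule {R : Type u} [CommRing R] (k : ℤ) (A M : ModuleCat.{u} R) :
    ModuleCat.{u} R :=
  match k with
  | Int.ofNat n => ((Tor (ModuleCat.{u} R) n).obj A).obj M
  | Int.negSucc _ => ModuleCat.of R PUnit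

end LocalCohomologyTor

namespace LocalCohomologyTor

section LongExactSequence

open Limits ZeroObject

variable {C : Type*} [Category* C] [Abelian C]

/-- The term of a cochain complex in the previous degree, zero in degree zero. -/
noncomputable def prevObj (K : CochainComplex C ℕ) : ℕ → C
  | 0 => 0
  | n + 1 => K.X n

/-- The differential out of the previous term. -/
noncomputable def prevD (K : CochainComplex C ℕ) : ∀ n, prevObj K n ⟶ K.X n
  | 0 => 0
  | n + 1 => K.d n (n + 1)

/-- A contractible complex that surjects degreewise split onto `K`. -/
noncomputable def coneCover (K : CochainComplex C ℕ) : CochainComplex C ℕ :=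
  CochainComplex.of (fun n => K.X n ⊞ prevObj K n)
    (fun n => biprod.fst ≫ (biprod.inr : K.X n ⟶ K.X (n + 1) ⊞ K.X n)) (fun n => by
      change (biprod.fst ≫ (biprod.inr : K.X n ⟶ K.X (n + 1) ⊞ K.X n)) ≫
        biprod.fst ≫ (biprod.inr : K.X (n + 1) ⟶ K.X (n + 2) ⊞ K.X (n + 1)) = 0
      simp)

lemma coneCover_d (K : CochainComplex C ℕ) (n : ℕ) : (coneCover K).d n (n + 1) =
    biprod.fst ≫ (biprod.inr : K.X n ⟶ K.X (n + 1) ⊞ K.X n) := by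
  change CochainComplex.of.d (fun n => K.X n ⊞ prevObj K n)
    (fun n => biprod.fst ≫ (biprod.inr : K.X n ⟶ K.X (n + 1) ⊞ K.X n)) n (n + 1) = _
  rw [CochainComplex.of_d]
  rfl

lemma mono_biprod_fst_of_isZero (X Y : C) (hY : IsZero Y) : Mono (biprod.fst : X ⊞ Y ⟶ X) :=
  ⟨fun f g h => by
    apply biprod.hom_ext
    · exact h
    · exact hY.eq_of_tgt _ _⟩

lemma mono_fst_inr (X X' Y : C) (hY : IsZero Y) :
    Mono ((biprod.fst : X ⊞ Y ⟶ X) ≫ (biprod.inr : X ⟶ X' ⊞ X)) := by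
  have := mono_biprod_fst_of_isZero X Y hY
  infer_instance

lemma exact_fst_inr (X Y Z W : C) : (ShortComplex.mk ((biprod.fst : X ⊞ Z ⟶ X) ≫
    (biprod.inr : X ⟶ Y ⊞ X)) ((biprod.fst : Y ⊞ X ⟶ Y) ≫ (biprod.inr : Y ⟶ W ⊞ Y))
      (by simp)).Exact := by
  rw [ShortComplex.exact_iff_exact_up_to_refinements]
  intro A x hx
  dsimp at x hx ⊢
  have hx' : x ≫ (biprod.fst : Y ⊞ X ⟶ Y) = 0 := by
    simpa using congrArg (· ≫ (biprod.snd : W ⊞ Y ⟶ Y)) hx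
  refine ⟨A, 𝟙 A, inferInstance, x ≫ (biprod.snd : Y ⊞ X ⟶ X) ≫
      (biprod.inl : X ⟶ X ⊞ Z), ?_⟩
  apply biprod.hom_ext
  · simpa using hx'
  · simp

lemma coneCover_exactAt (K : CochainComplex C ℕ) (n : ℕ) : (coneCover K).ExactAt n := by
  cases n with
  | zero =>
    rw [HomologicalComplex.exactAt_iff' _ 0 0 1 (by simp) (by simp)]
    have : Mono ((coneCover K).d 0 1) := by
      rw [coneCover_d]
      exact mono_fst_inr (K.X 0) (K.X 1) 0 (isZero_zero C)
    exact (ShortComplex.exact_iff_mono _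
      ((coneCover K).shape _ _ (by simp) : (coneCover K).d 0 0 = 0)).2 this
  | succ n =>
    rw [HomologicalComplex.exactAt_iff' _ n (n + 1) (n + 2) (by simp) (by simp)]
    refine (ShortComplex.exact_iff_of_iso ?_).1
      (exact_fst_inr (K.X n) (K.X (n + 1)) (prevObj K n) (K.X (n + 2)))
    refine ShortComplex.isoMk (Iso.refl _) (Iso.refl _) (Iso.refl _) ?_ ?_
    · exact (Category.id_comp _).trans ((coneCover_d K n).trans (Category.comp_id _).symm)
    · exact (Category.id_comp _).trans ((coneCover_d K (n + 1)).trans (Category.comp_id _).symm)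

/-- The degreewise split epimorphism `coneCover K ⟶ K`. -/
noncomputable def coneCoverπ (K : CochainComplex C ℕ) : coneCover K ⟶ K where
  f n := (biprod.desc (𝟙 _) (prevD K n) : K.X n ⊞ prevObj K n ⟶ K.X n)
  comm' i j hij := by
    obtain rfl : i + 1 = j := hij
    rw [coneCover_d]
    change (biprod.desc (𝟙 _) (prevD K i) : K.X i ⊞ prevObj K i ⟶ K.X i) ≫ _ =
      (biprod.fst ≫ (biprod.inr : K.X i ⟶ K.X (i + 1) ⊞ K.X i)) ≫
      (biprod.desc (𝟙 _) (K.d i (i + 1)) : K.X (i + 1) ⊞ K.X i ⟶ K.X (i + 1))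
    rw [Category.assoc, biprod.inr_desc]
    apply biprod.hom_ext'
    · simp
    · cases i with
      | zero => exact (isZero_zero C).eq_of_src _ _
      | succ i =>
        change biprod.inr ≫ (biprod.desc (𝟙 _) (K.d i (i + 1)) :
          K.X (i + 1) ⊞ K.X i ⟶ K.X (i + 1)) ≫ _ = biprod.inr ≫ biprod.fst ≫ _
        simp

lemma exists_section_coneCoverπ (K : CochainComplex C ℕ) (n : ℕ) :
    ∃ s : K.X n ⟶ (coneCover K).X n, s ≫ (coneCoverπ K).f n = 𝟙 _ :=
  ⟨(biprod.inl : K.X n ⟶ K.X n ⊞ prevObj K n), biprod.inl_desc _ _⟩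

lemma coneCover_injective (K : CochainComplex C ℕ) [∀ n, Injective (K.X n)] (n : ℕ) :
    Injective ((coneCover K).X n) := by
  have : Injective (prevObj K n) := by
    cases n with
    | zero => exact Injective.zero_injective
    | succ n => exact inferInstanceAs (Injective (K.X n))
  exact inferInstanceAs (Injective (K.X n ⊞ prevObj K n))

/-- An injective resolution from a degreewise injective exact complex with an augmentation. -/
noncomputable def injectiveResolutionMk {Z : C} (K : CochainComplex C ℕ)
    (hK : ∀ n, Injective (K.X n)) (hex : ∀ n, K.ExactAt (n + 1)) (i : Z ⟶ K.X 0) [Mono i]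
    (w : i ≫ K.d 0 1 = 0) (hi : (ShortComplex.mk i (K.d 0 1) w).Exact) :
    InjectiveResolution Z where
  cocomplex := K
  ι := (CochainComplex.fromSingle₀Equiv _ _).symm ⟨i, w⟩
  quasiIso := ⟨fun n => by
    cases n
    · have h0 : ((CochainComplex.fromSingle₀Equiv K Z).symm ⟨i, w⟩).f 0 = i :=
        CochainComplex.fromSingle₀Equiv_symm_apply_f_zero i w
      rw [CochainComplex.quasiIsoAt₀_iff, ShortComplex.quasiIso_iff_of_zeros]
      · refine (ShortComplex.exact_and_mono_f_iff_of_iso ?_).2 ⟨hi, by dsimp; infer_instance⟩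
        exact ShortComplex.isoMk (Iso.refl _) (Iso.refl _) (Iso.refl _)
          ((Category.id_comp i).trans (h0.symm.trans (Category.comp_id _).symm))
          ((Category.id_comp (K.d 0 1)).trans (Category.comp_id (K.d 0 1)).symm)
      · rfl
      · rfl
      · exact (K.shape 0 0 (by simp) : K.d 0 0 = 0)
    · rw [quasiIsoAt_iff_exactAt]
      · apply hex
      · apply CochainComplex.exactAt_succ_single_obj⟩


/-- The augmentation of an injective resolution. -/
def augmentation {Z : C} (I : InjectiveResolution Z) : Z ⟶ I.cocomplex.X 0 := I.ι.f 0

instance {Z : C} (I : InjectiveResolution Z) : Mono (augmentation I) :=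
  inferInstanceAs (Mono (I.ι.f 0))

lemma augmentation_comp_d {Z : C} (I : InjectiveResolution Z) :
    augmentation I ≫ I.cocomplex.d 0 1 = 0 := I.ι_f_zero_comp_complex_d

lemma augmentation_exact {Z : C} (I : InjectiveResolution Z) :
    (ShortComplex.mk _ _ (augmentation_comp_d I)).Exact :=
  ShortComplex.exact_of_f_is_kernel _ I.isLimitKernelFork

lemma injectiveResolutionMk_ι_f_zero {Z : C} (K : CochainComplex C ℕ)
    (hK : ∀ n, Injective (K.X n)) (hex : ∀ n, K.ExactAt (n + 1)) (i : Z ⟶ K.X 0) [Mono i]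
    (w : i ≫ K.d 0 1 = 0) (hi : (ShortComplex.mk i (K.d 0 1) w).Exact) :
    augmentation (injectiveResolutionMk K hK hex i w hi) = i :=
  CochainComplex.fromSingle₀Equiv_symm_apply_f_zero i w

lemma quasiIso_biprod_inl (K L : CochainComplex C ℕ) (hL : ∀ n, L.ExactAt n) :
    QuasiIso (biprod.inl : K ⟶ K ⊞ L) := ⟨fun n => by
  rw [quasiIsoAt_iff_isIso_homologyMap]
  refine ⟨HomologicalComplex.homologyMap biprod.fst n, ?_, ?_⟩
  · rw [← HomologicalComplex.homologyMap_comp, biprod.inl_fst, HomologicalComplex.homologyMap_id]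
  · have h0 : HomologicalComplex.homologyMap (biprod.snd : K ⊞ L ⟶ L) n ≫
        HomologicalComplex.homologyMap (biprod.inr : L ⟶ K ⊞ L) n = 0 := by
      rw [((HomologicalComplex.exactAt_iff_isZero_homology _ _).1 (hL n)).eq_of_tgt
        (HomologicalComplex.homologyMap (biprod.snd : K ⊞ L ⟶ L) n) 0, zero_comp]
    rw [← HomologicalComplex.homologyMap_comp] at h0 ⊢
    rw [← HomologicalComplex.homologyMap_id, ← biprod.total, HomologicalComplex.homologyMap_add,
      h0, add_zero]⟩

/-- The kernel of a degreewise split epimorphism between injective resolutions of the last two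
terms of a short exact sequence resolves the first term. -/
lemma exists_injectiveResolution_kernel {S : ShortComplex C} (hS : S.ShortExact)
    (I₂ : InjectiveResolution S.X₂) (I₃ : InjectiveResolution S.X₃)
    (ψ : I₂.cocomplex ⟶ I₃.cocomplex) (hψ : augmentation I₂ ≫ ψ.f 0 = S.g ≫ augmentation I₃)
    (hsec : ∀ n, ∃ s, s ≫ ψ.f n = 𝟙 _) :
    ∃ (I₁ : InjectiveResolution S.X₁) (α : I₁.cocomplex ⟶ I₂.cocomplex) (w : α ≫ ψ = 0),
      augmentation I₁ ≫ α.f 0 = S.f ≫ augmentation I₂ ∧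
      ∀ n, Nonempty ((ShortComplex.mk α ψ w).map (HomologicalComplex.eval C _ n)).Splitting := by
  have := hS.mono_f
  have := hS.epi_g
  obtain ⟨K, k, hk, hex, hkm⟩ : ∃ (K : CochainComplex C ℕ) (k : K ⟶ I₂.cocomplex) (hk : k ≫ ψ = 0),
      (ShortComplex.mk k ψ hk).Exact ∧ Mono k :=
    ⟨_, _, kernel.condition ψ, ShortComplex.exact_of_f_is_kernel _ (kernelIsKernel ψ),
      inferInstance⟩
  have hexn (n : ℕ) : (ShortComplex.mk (k.f n) (ψ.f n)
      (by rw [← HomologicalComplex.comp_f, hk, HomologicalComplex.zero_f])).Exact :=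
    hex.map (HomologicalComplex.eval C (ComplexShape.up ℕ) n)
  have hsplit (n : ℕ) : Nonempty ((ShortComplex.mk k ψ hk).map
      (HomologicalComplex.eval C _ n)).Splitting := by
    obtain ⟨s, hs⟩ := hsec n
    exact ⟨ShortComplex.Splitting.ofExactOfSection _ (hexn n) s hs
      (inferInstanceAs (Mono (k.f n)))⟩
  have hKinj (n : ℕ) : Injective (K.X n) := by
    obtain ⟨σ⟩ := hsplit n
    exact Retract.injective (Y := I₂.cocomplex.X n) ⟨k.f n, σ.r, σ.f_r⟩
      (i := I₂.injective n)
  have hT : (ShortComplex.mk k ψ hk).ShortExact :=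
    HomologicalComplex.shortExact_of_degreewise_shortExact _
      fun n => (hsplit n).some.shortExact
  have hι : (S.f ≫ augmentation I₂) ≫ ψ.f 0 = 0 := by
    rw [Category.assoc, hψ, S.zero_assoc, zero_comp]
  let i : S.X₁ ⟶ K.X 0 := (hexn 0).lift _ hι
  have hi : i ≫ k.f 0 = S.f ≫ augmentation I₂ := (hexn 0).lift_f _ hι
  have : Mono i := by
    have : Mono (i ≫ k.f 0) := by rw [hi]; infer_instance
    exact mono_of_mono i (k.f 0)
  have hw : i ≫ K.d 0 1 = 0 := by
    rw [← cancel_mono (k.f 1), Category.assoc, ← k.comm, reassoc_of% hi,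
      augmentation_comp_d, comp_zero, zero_comp]
  refine ⟨injectiveResolutionMk K hKinj ?_ i hw ?_, k, hk, ?_, hsplit⟩
  · intro n
    refine hT.exactAt_X₁ (n + 1) ?_ ?_
    · refine ⟨fun f g _ => ?_⟩
      exact ((HomologicalComplex.exactAt_iff_isZero_homology _ _).1
        (I₂.cocomplex_exactAt_succ n)).eq_of_tgt _ _
    · rintro m hm
      obtain rfl : m = n := by simpa using hm
      cases m with
      | succ m =>
        exact ⟨fun f g _ => ((HomologicalComplex.exactAt_iff_isZero_homology _ _).1
          (I₃.cocomplex_exactAt_succ m)).eq_of_src _ _⟩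
      | zero => 
        have h1 : I₂.ι ≫ ψ = (CochainComplex.single₀ C).map S.g ≫ I₃.ι := by
          apply HomologicalComplex.from_single_hom_ext
          have h5 : ((CochainComplex.single₀ C).map S.g).f 0 = S.g := by simp
          rw [HomologicalComplex.comp_f, HomologicalComplex.comp_f, h5]
          exact hψ
        have h2 : HomologicalComplex.homologyMap (I₂.ι ≫ ψ) 0 = _ :=
          congrArg (HomologicalComplex.homologyMap · 0) h1
        rw [HomologicalComplex.homologyMap_comp, HomologicalComplex.homologyMap_comp] at h2
        have : Epi (HomologicalComplex.homologyMap ((CochainComplex.single₀ C).map S.g) 0) := by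
          have e := HomologicalComplex.homologyFunctorSingleIso C (ComplexShape.up ℕ) 0
          have h6 := NatIso.naturality_2 e S.g
          change _ = HomologicalComplex.homologyMap ((CochainComplex.single₀ C).map S.g) 0 at h6
          rw [← h6]
          have e₂ : Epi (e.hom.app S.X₂) := inferInstanceAs (Epi (e.app S.X₂).hom)
          have e₃ : Epi (e.inv.app S.X₃) := inferInstanceAs (Epi (e.app S.X₃).inv)
          exact epi_comp' e₂ (epi_comp' hS.epi_g e₃)
        have h3 : Epi (HomologicalComplex.homologyMap I₂.ι 0 ≫
            HomologicalComplex.homologyMap ψ 0) := by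
          rw [h2]
          exact epi_comp _ _
        exact epi_of_epi (HomologicalComplex.homologyMap I₂.ι 0) _
  · rw [ShortComplex.exact_iff_exact_up_to_refinements]
    intro A x hx
    change A ⟶ K.X 0 at x
    change x ≫ K.d 0 1 = 0 at hx
    have hx1 : (x ≫ k.f 0) ≫ I₂.cocomplex.d 0 1 = 0 := by
      rw [Category.assoc, k.comm, reassoc_of% hx, zero_comp]
    obtain ⟨y, hy⟩ : ∃ y, y ≫ augmentation I₂ = x ≫ k.f 0 :=
      ⟨(augmentation_exact I₂).lift _ hx1, (augmentation_exact I₂).lift_f _ hx1⟩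
    have hyg : y ≫ S.g = 0 := by
      rw [← cancel_mono (augmentation I₃), Category.assoc, ← hψ, reassoc_of% hy,
        ← HomologicalComplex.comp_f, hk, HomologicalComplex.zero_f, comp_zero, zero_comp]
    refine ⟨A, 𝟙 A, inferInstance, hS.exact.lift y hyg, ?_⟩
    have h4 : hS.exact.lift y hyg ≫ S.f ≫ augmentation I₂ = x ≫ k.f 0 := by
      rw [← Category.assoc, hS.exact.lift_f, hy]
    rw [← cancel_mono (k.f 0), Category.assoc, Category.assoc, Category.id_comp]
    exact h4.symm.trans (by rw [← hi])
  · rw [injectiveResolutionMk_ι_f_zero]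
    exact hi

/-- A short exact sequence is resolved by a degreewise split short exact sequence of injective
resolutions. -/
lemma exists_injectiveResolution_shortExact [EnoughInjectives C] {S : ShortComplex C}
    (hS : S.ShortExact) :
    ∃ (I₁ : InjectiveResolution S.X₁) (I₂ : InjectiveResolution S.X₂)
      (I₃ : InjectiveResolution S.X₃) (α : I₁.cocomplex ⟶ I₂.cocomplex)
      (β : I₂.cocomplex ⟶ I₃.cocomplex) (w : α ≫ β = 0),
      augmentation I₁ ≫ α.f 0 = S.f ≫ augmentation I₂ ∧
      augmentation I₂ ≫ β.f 0 = S.g ≫ augmentation I₃ ∧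
      ∀ n, Nonempty ((ShortComplex.mk α β w).map (HomologicalComplex.eval C _ n)).Splitting := by
  let IB := InjectiveResolution.of S.X₂
  let I₃ := InjectiveResolution.of S.X₃
  let P := coneCover I₃.cocomplex
  have := coneCover_injective I₃.cocomplex
  have hq : QuasiIso (biprod.inl : IB.cocomplex ⟶ IB.cocomplex ⊞ P) :=
    quasiIso_biprod_inl _ _ (coneCover_exactAt _)
  let I₂ : InjectiveResolution S.X₂ :=
    { cocomplex := IB.cocomplex ⊞ P
      injective := fun n => Injective.of_iso (HomologicalComplex.biprodXIso _ _ n).symm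
        inferInstance
      ι := IB.ι ≫ biprod.inl }
  let φ := InjectiveResolution.desc S.g I₃ IB
  let ψ : IB.cocomplex ⊞ P ⟶ I₃.cocomplex := biprod.desc φ (coneCoverπ _)
  have hψ : augmentation I₂ ≫ ψ.f 0 = S.g ≫ augmentation I₃ := by
    have : I₂.ι ≫ ψ = IB.ι ≫ φ := by simp [I₂, ψ]
    have h3 := congrArg (fun f => f.f 0) this
    exact h3.trans (InjectiveResolution.desc_commutes_zero S.g I₃ IB)
  have hsec (n : ℕ) : ∃ s, s ≫ ψ.f n = 𝟙 _ := by
    obtain ⟨s, hs⟩ := exists_section_coneCoverπ I₃.cocomplex n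
    refine ⟨s ≫ (biprod.inr : P ⟶ IB.cocomplex ⊞ P).f n, ?_⟩
    rw [Category.assoc, ← HomologicalComplex.comp_f, biprod.inr_desc, hs]
  obtain ⟨I₁, α, w, h1, h2⟩ := exists_injectiveResolution_kernel hS I₂ I₃ ψ hψ hsec
  exact ⟨I₁, I₂, I₃, α, ψ, w, h1, hψ, h2⟩

variable {D : Type*} [Category* D] [Abelian D] [EnoughInjectives C]

instance (F : C ⥤ D) [F.Additive] (n : ℕ) : (F.rightDerived n).Additive where
  map_add {X Y f g} := by
    let I := InjectiveResolution.of X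
    let J := InjectiveResolution.of Y
    let φ := InjectiveResolution.desc f J I
    let ψ := InjectiveResolution.desc g J I
    have hφ := InjectiveResolution.isoRightDerivedObj_hom_naturality f I J φ
      (InjectiveResolution.desc_commutes_zero f J I) F n
    have hψ := InjectiveResolution.isoRightDerivedObj_hom_naturality g I J ψ
      (InjectiveResolution.desc_commutes_zero g J I) F n
    have hφ₀ : augmentation I ≫ φ.f 0 = f ≫ augmentation J :=
      InjectiveResolution.desc_commutes_zero f J I
    have hψ₀ : augmentation I ≫ ψ.f 0 = g ≫ augmentation J :=
      InjectiveResolution.desc_commutes_zero g J I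
    have hsum : augmentation I ≫ (φ + ψ).f 0 = (f + g) ≫ augmentation J := by
      rw [HomologicalComplex.add_f_apply, Preadditive.comp_add, Preadditive.add_comp, hφ₀, hψ₀]
    have h := InjectiveResolution.isoRightDerivedObj_hom_naturality (f + g) I J (φ + ψ) hsum F n
    rw [← cancel_mono (J.isoRightDerivedObj F n).hom, h, Preadditive.add_comp, hφ, hψ,
      Functor.map_add, Preadditive.comp_add]

instance {k : Type*} [Ring k] [Linear k C] [Linear k D] (F : C ⥤ D) [F.Additive] [F.Linear k]
    (n : ℕ) : (F.rightDerived n).Linear k where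
  map_smul {X Y} f r := by
    let I := InjectiveResolution.of X
    let J := InjectiveResolution.of Y
    let φ := InjectiveResolution.desc f J I
    have hφ := InjectiveResolution.isoRightDerivedObj_hom_naturality f I J φ
      (InjectiveResolution.desc_commutes_zero f J I) F n
    have hφ₀ : augmentation I ≫ φ.f 0 = f ≫ augmentation J :=
      InjectiveResolution.desc_commutes_zero f J I
    have hsmul : augmentation I ≫ (r • φ).f 0 = (r • f) ≫ augmentation J := by
      rw [HomologicalComplex.smul_f_apply, Linear.comp_smul, Linear.smul_comp, hφ₀]
    have h := InjectiveResolution.isoRightDerivedObj_hom_naturality (r • f) I J (r • φ) hsmul F n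
    rw [← cancel_mono (J.isoRightDerivedObj F n).hom, h, Linear.smul_comp, hφ,
      ← Linear.comp_smul]
    congr 1
    change HomologicalComplex.homologyMap ((F.mapHomologicalComplex _).map (r • φ)) n = _
    rw [Functor.map_smul]
    exact ShortComplex.homologyMap_smul
      ((HomologicalComplex.shortComplexFunctor D (ComplexShape.up ℕ) n).map
        ((F.mapHomologicalComplex _).map (InjectiveResolution.desc f _ _))) r

/-- The long exact sequence of right derived functors. -/
theorem rightDerived_longExact (F : C ⥤ D) [F.Additive] {S : ShortComplex C} (hS : S.ShortExact)
    (n : ℕ) : (S.map (F.rightDerived n)).Exact ∧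
    ∃ (δ : (F.rightDerived n).obj S.X₃ ⟶ (F.rightDerived (n + 1)).obj S.X₁)
      (w₁ : (F.rightDerived n).map S.g ≫ δ = 0) (w₂ : δ ≫ (F.rightDerived (n + 1)).map S.f = 0),
      (ShortComplex.mk _ _ w₁).Exact ∧ (ShortComplex.mk _ _ w₂).Exact := by
  obtain ⟨I₁, I₂, I₃, α, β, w, hα, hβ, hsplit⟩ := exists_injectiveResolution_shortExact hS
  let G := F.mapHomologicalComplex (ComplexShape.up ℕ)
  let T : ShortComplex (CochainComplex D ℕ) := (ShortComplex.mk α β w).map G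
  have hT : T.ShortExact := HomologicalComplex.shortExact_of_degreewise_shortExact _ fun i => by
    obtain ⟨σ⟩ := hsplit i
    exact (σ.map F).shortExact
  obtain ⟨e₁, e₂, e₃, nα, nβ⟩ : ∃ (e₁ : ∀ i, (F.rightDerived i).obj S.X₁ ≅ T.X₁.homology i)
      (e₂ : ∀ i, (F.rightDerived i).obj S.X₂ ≅ T.X₂.homology i)
      (e₃ : ∀ i, (F.rightDerived i).obj S.X₃ ≅ T.X₃.homology i),
      (∀ i, (F.rightDerived i).map S.f ≫ (e₂ i).hom =
        (e₁ i).hom ≫ HomologicalComplex.homologyMap T.f i) ∧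
      (∀ i, (F.rightDerived i).map S.g ≫ (e₃ i).hom =
        (e₂ i).hom ≫ HomologicalComplex.homologyMap T.g i) :=
    ⟨I₁.isoRightDerivedObj F, I₂.isoRightDerivedObj F, I₃.isoRightDerivedObj F,
      InjectiveResolution.isoRightDerivedObj_hom_naturality S.f I₁ I₂ α hα F,
      InjectiveResolution.isoRightDerivedObj_hom_naturality S.g I₂ I₃ β hβ F⟩
  have hrel : (ComplexShape.up ℕ).Rel n (n + 1) := rfl
  have w₁ : (F.rightDerived n).map S.g ≫ (e₃ n).hom ≫ hT.δ n (n + 1) hrel ≫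
      (e₁ (n + 1)).inv = 0 := by
    rw [reassoc_of% (nβ n), reassoc_of% (hT.comp_δ n (n + 1) hrel), zero_comp, comp_zero]
  have w₂ : ((e₃ n).hom ≫ hT.δ n (n + 1) hrel ≫ (e₁ (n + 1)).inv) ≫
      (F.rightDerived (n + 1)).map S.f = 0 := by
    rw [← cancel_mono (e₂ (n + 1)).hom, Category.assoc, Category.assoc,
      Category.assoc, nα, Iso.inv_hom_id_assoc, hT.δ_comp n (n + 1) hrel, comp_zero, zero_comp]
  have hδ : (e₃ n).hom ≫ hT.δ n (n + 1) hrel =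
      ((e₃ n).hom ≫ hT.δ n (n + 1) hrel ≫ (e₁ (n + 1)).inv) ≫ (e₁ (n + 1)).hom := by
    simp
  refine ⟨?_, _, w₁, w₂, ?_, ?_⟩
  · exact (ShortComplex.exact_iff_of_iso (ShortComplex.isoMk (S₂ := ShortComplex.mk _ _ _)
      (e₁ n) (e₂ n) (e₃ n) (nα n).symm (nβ n).symm)).2 (hT.homology_exact₂ n)
  · exact (ShortComplex.exact_iff_of_iso (ShortComplex.isoMk (S₂ := ShortComplex.mk _ _ _)
      (e₂ n) (e₃ n) (e₁ (n + 1)) (nβ n).symm hδ)).2 (hT.homology_exact₃ n (n + 1) hrel)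
  · exact (ShortComplex.exact_iff_of_iso (ShortComplex.isoMk (S₂ := ShortComplex.mk _ _ _)
      (e₃ n) (e₁ (n + 1)) (e₂ (n + 1)) hδ (nα (n + 1)).symm)).2
      (hT.homology_exact₁ n (n + 1) hrel)


/-- An exact functor that preserves injective objects preserves injective resolutions. -/
noncomputable def mapInjectiveResolution (Φ : C ⥤ D) [Φ.Additive] [Φ.PreservesInjectiveObjects]
    [Φ.PreservesHomology] {Z : C} (I : InjectiveResolution Z) :
    InjectiveResolution (Φ.obj Z) where
  cocomplex := (Φ.mapHomologicalComplex _).obj I.cocomplex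
  injective n := Functor.PreservesInjectiveObjects.injective_obj (I.injective n)
  ι := (HomologicalComplex.singleMapHomologicalComplex _ _ _).inv.app _ ≫
    (Φ.mapHomologicalComplex _).map I.ι
  quasiIso := inferInstance

end LongExactSequence

section LocalCohomology

variable {R : Type u} [CommRing R] (a : Ideal R)

instance : (torsionFunctor a).Linear R where

instance : Limits.PreservesFiniteLimits (torsionFunctor a) := by
  refine (((torsionFunctor a).preservesFiniteLimits_tfae).out 0 3).1 ?_
  intro S hS
  have hinj := hS.moduleCat_injective_f
  have hex := (ShortComplex.ShortExact.moduleCat_exact_iff_function_exact S).1 hS.exact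
  refine ⟨?_, ?_⟩
  · rw [ShortComplex.ShortExact.moduleCat_exact_iff_function_exact]
    intro x
    constructor
    · intro hx
      obtain ⟨y, hy⟩ := (hex x.1).1 (congrArg Subtype.val hx)
      obtain ⟨m, hm⟩ := x.2
      refine ⟨⟨y, m, fun r hr => hinj ?_⟩, Subtype.ext hy⟩
      rw [map_smul, map_zero]
      exact (congrArg (r • ·) hy).trans (hm r hr)
    · rintro ⟨y, rfl⟩
      exact Subtype.ext ((hex _).2 ⟨y.1, rfl⟩)
  · rw [ModuleCat.mono_iff_injective]
    intro x y hxy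
    exact Subtype.ext (hinj (congrArg Subtype.val hxy))

/-- Local cohomology in degree `n` of a module. -/
abbrev lc (n : ℕ) (N : Type u) [AddCommGroup N] [Module R N] : Type u :=
  ((torsionFunctor a).rightDerived n).obj (ModuleCat.of R N)

variable {N N' N'' : Type u} [AddCommGroup N] [Module R N] [AddCommGroup N'] [Module R N']
  [AddCommGroup N''] [Module R N'']

/-- The map induced on local cohomology. -/
noncomputable def lcMap (n : ℕ) (f : N →ₗ[R] N') : lc a n N →ₗ[R] lc a n N' :=
  (((torsionFunctor a).rightDerived n).map (ModuleCat.ofHom f)).hom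

lemma lcMap_id (n : ℕ) : lcMap a n (LinearMap.id : N →ₗ[R] N) = LinearMap.id := by
  rw [lcMap, ModuleCat.ofHom_id, CategoryTheory.Functor.map_id, ModuleCat.hom_id]

lemma lcMap_comp (n : ℕ) (g : N' →ₗ[R] N'') (f : N →ₗ[R] N') :
    lcMap a n (g ∘ₗ f) = lcMap a n g ∘ₗ lcMap a n f := by
  simp only [lcMap]
  rw [ModuleCat.ofHom_comp, Functor.map_comp, ModuleCat.hom_comp]

lemma lcMap_smul (n : ℕ) (r : R) (f : N →ₗ[R] N') : lcMap a n (r • f) = r • lcMap a n f := by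
  have : ModuleCat.ofHom (r • f) = r • ModuleCat.ofHom f := rfl
  simp only [lcMap, this, Functor.map_smul]
  rfl

lemma lcMap_add (n : ℕ) (f g : N →ₗ[R] N') : lcMap a n (f + g) = lcMap a n f + lcMap a n g := by
  have : ModuleCat.ofHom (f + g) = ModuleCat.ofHom f + ModuleCat.ofHom g := rfl
  simp only [lcMap, this, Functor.map_add]
  rfl

/-- Local cohomology in degree `n` as a linear map on homomorphisms. -/
noncomputable def lcMapₗ (n : ℕ) : (N →ₗ[R] N') →ₗ[R] (lc a n N →ₗ[R] lc a n N') where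
  toFun := lcMap a n
  map_add' := lcMap_add a n
  map_smul' := lcMap_smul a n

/-- Isomorphic modules have isomorphic local cohomology. -/
noncomputable def lcCongr (n : ℕ) (e : N ≃ₗ[R] N') : lc a n N ≃ₗ[R] lc a n N' :=
  LinearEquiv.ofLinearMap (lcMap a n e.toLinearMap) (lcMap a n e.symm.toLinearMap)
    (by rw [← lcMap_comp, LinearEquiv.comp_symm, lcMap_id])
    (by rw [← lcMap_comp, LinearEquiv.symm_comp, lcMap_id])

theorem lc_longExact {f : N →ₗ[R] N'} {g : N' →ₗ[R] N''} (hf : Function.Injective f)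
    (hfg : Function.Exact f g) (hg : Function.Surjective g) (n : ℕ) :
    Function.Exact (lcMap a n f) (lcMap a n g) ∧
    ∃ δ : lc a n N'' →ₗ[R] lc a (n + 1) N, Function.Exact (lcMap a n g) δ ∧
      Function.Exact δ (lcMap a (n + 1) f) := by
  let S : ShortComplex (ModuleCat.{u} R) :=
    ModuleCat.shortComplexOfCompEqZero f g hfg.linearMap_comp_eq_zero
  have hS : S.ShortExact := ModuleCat.shortComplex_shortExact S hfg hf hg
  obtain ⟨h, δ, w₁, w₂, h₁, h₂⟩ := rightDerived_longExact (torsionFunctor a) hS n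
  rw [ShortComplex.ShortExact.moduleCat_exact_iff_function_exact] at h h₁ h₂
  exact ⟨h, δ.hom, h₁, h₂⟩

lemma lc_succ_subsingleton_of_injective (n : ℕ) [Module.Injective R N] :
    Subsingleton (lc a (n + 1) N) := by
  have : Injective (ModuleCat.of R N) := Module.injective_object_of_injective_module R N
  exact ModuleCat.isZero_iff_subsingleton.1
    (Functor.isZero_rightDerived_obj_injective_succ (torsionFunctor a) n (ModuleCat.of R N))

/-- Local cohomology in degree zero is the torsion submodule. -/
noncomputable def lcZero : lc a 0 N ≃ₗ[R] torsionSubmodule a N :=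
  (((torsionFunctor a).rightDerivedZeroIsoSelf).app (ModuleCat.of R N)).toLinearEquiv

lemma lcZero_lcMap (f : N →ₗ[R] N') (x : lc a 0 N) :
    (lcZero a (lcMap a 0 f x) : N') = f (lcZero a x : N) := by
  have := ((torsionFunctor a).rightDerivedZeroIsoSelf).hom.naturality (ModuleCat.ofHom f)
  exact congrArg Subtype.val (congrArg (fun g => g.hom x) this)

variable (R) in
lemma exists_injective_embedding (N : Type u) [AddCommGroup N] [Module R N] :
    ∃ (J : Type u) (_ : AddCommGroup J) (_ : Module R J) (i : N →ₗ[R] J),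
      Module.Injective R J ∧ Function.Injective i := by
  obtain ⟨J, hJ, i, hi⟩ := (inferInstance : EnoughInjectives (ModuleCat.{u} R)).presentation
    (ModuleCat.of R N)
  exact ⟨J, inferInstance, inferInstance, i.hom, Module.injective_module_of_injective_object R J,
    (ModuleCat.mono_iff_injective i).1 hi⟩

lemma lc_torsion (n : ℕ) (x : lc a n N) : ∃ m : ℕ, ∀ r ∈ a ^ m, r • x = 0 := by
  induction n generalizing N with
  | zero =>
    obtain ⟨m, hm⟩ := (lcZero a x).2
    refine ⟨m, fun r hr => (lcZero a).injective ?_⟩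
    rw [map_smul, map_zero]
    exact Subtype.ext (hm r hr)
  | succ n ih =>
    obtain ⟨J, _, _, i, _, hi⟩ := exists_injective_embedding R N
    obtain ⟨-, δ, -, h⟩ := lc_longExact a hi (LinearMap.exact_map_mkQ_range i)
      (Submodule.mkQ_surjective _) n
    have := lc_succ_subsingleton_of_injective a n (N := J)
    obtain ⟨y, rfl⟩ := (h x).1 (Subsingleton.elim _ _)
    obtain ⟨m, hm⟩ := ih y
    exact ⟨m, fun r hr => by rw [← map_smul, hm r hr, map_zero]⟩

/-- Dimension shifting along a short exact sequence with acyclic middle term. -/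
lemma lc_shift {f : N →ₗ[R] N'} {g : N' →ₗ[R] N''} (hf : Function.Injective f)
    (hfg : Function.Exact f g) (hg : Function.Surjective g) (n : ℕ)
    [Subsingleton (lc a n N')] [Subsingleton (lc a (n + 1) N')] :
    Nonempty (lc a n N'' ≃ₗ[R] lc a (n + 1) N) := by
  obtain ⟨-, δ, h₁, h₂⟩ := lc_longExact a hf hfg hg n
  refine ⟨LinearEquiv.ofBijective δ ⟨?_, fun x => (h₂ x).1 (Subsingleton.elim _ _)⟩⟩
  rw [injective_iff_map_eq_zero]
  intro x hx
  obtain ⟨y, rfl⟩ := (h₁ x).1 hx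
  rw [Subsingleton.elim y 0, map_zero]

end LocalCohomology

section Noetherian

open scoped Pointwise

variable {R : Type u} [CommRing R] (a : Ideal R)

lemma mem_torsionSubmodule_of_fg {N : Type u} [AddCommGroup N] [Module R N]
    {P : Submodule R N} (hP : P.FG) (h : P ≤ torsionSubmodule a N) :
    ∃ m : ℕ, ∀ r ∈ a ^ m, ∀ x ∈ P, r • x = 0 := by
  induction P, hP using Submodule.fg_induction with
  | singleton x =>
    obtain ⟨m, hm⟩ := h (Submodule.mem_span_singleton_self x)
    refine ⟨m, fun r hr y hy => ?_⟩
    obtain ⟨c, rfl⟩ := Submodule.mem_span_singleton.1 hy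
    rw [smul_comm, hm r hr, smul_zero]
  | sup P Q hP hQ ihP ihQ =>
    obtain ⟨m, hm⟩ := ihP (le_sup_left.trans h)
    obtain ⟨n, hn⟩ := ihQ (le_sup_right.trans h)
    refine ⟨m + n, fun r hr y hy => ?_⟩
    obtain ⟨y, hy', z, hz, rfl⟩ := Submodule.mem_sup.1 hy
    rw [smul_add, hm r (Ideal.pow_le_pow_right (Nat.le_add_right m n) hr) y hy',
      hn r (Ideal.pow_le_pow_right (Nat.le_add_left n m) hr) z hz, add_zero]

/-- Baer's criterion for torsion modules over a noetherian ring. -/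
theorem injective_of_torsion [IsNoetherianRing R] {W : Type u} [AddCommGroup W] [Module R W]
    (hW : ∀ w : W, ∃ m : ℕ, ∀ r ∈ a ^ m, r • w = 0)
    (H : ∀ (I : Ideal R) (n : ℕ) (g : I →ₗ[R] W), a ^ n ≤ I →
      (∀ x : I, (x : R) ∈ a ^ n → g x = 0) → ∃ w : W, ∀ x : I, g x = (x : R) • w) :
    Module.Injective R W := by
  refine Module.Baer.injective fun I g => ?_
  have hfg : (LinearMap.range g).FG := by
    rw [LinearMap.range_eq_map]
    exact Submodule.FG.map g (IsNoetherian.noetherian _)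
  obtain ⟨n, hn⟩ := mem_torsionSubmodule_of_fg a hfg fun w _ => hW w
  obtain ⟨k, hk⟩ := Ideal.exists_pow_inf_eq_pow_smul a (I : Submodule R R)
  have hker : ∀ x : I, (x : R) ∈ a ^ (k + n) → g x = 0 := by
    intro x hx
    have hx' : (x : R) ∈ a ^ n • (I : Submodule R R) := by
      have : (x : R) ∈ a ^ (k + n) • (⊤ : Submodule R R) ⊓ I :=
        ⟨by simpa using hx, x.2⟩
      rw [hk _ (Nat.le_add_right k n), Nat.add_sub_cancel_left] at this
      exact Submodule.smul_mono le_rfl inf_le_right this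
    have hx'' : x ∈ a ^ n • (⊤ : Submodule R I) := by
      have : (a ^ n • (⊤ : Submodule R I)).map I.subtype = a ^ n • (I : Submodule R R) := by
        rw [Submodule.map_smul'', Submodule.map_top, Submodule.range_subtype]
      rw [← this] at hx'
      obtain ⟨y, hy, hyx⟩ := hx'
      rwa [← Subtype.ext hyx]
    exact Submodule.smul_induction_on (p := fun y => g y = 0) hx''
      (fun r hr y _ => by rw [map_smul, hn r hr _ ⟨y, rfl⟩])
      (fun y z hy hz => by rw [map_add, hy, hz, add_zero])
  let G : R →ₗ.[R] W := ⟨I, g⟩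
  let Z : R →ₗ.[R] W := ⟨a ^ (k + n), 0⟩
  have hGZ : ∀ (x : G.domain) (y : Z.domain), (x : R) = y → G x = Z y := by
    intro x y hxy
    exact hker x (hxy ▸ y.2)
  have hle := LinearPMap.left_le_sup G Z hGZ
  have hle' := LinearPMap.right_le_sup G Z hGZ
  obtain ⟨w, hw⟩ := H (G.sup Z hGZ).domain (k + n) (G.sup Z hGZ).toFun hle'.1
    (fun x hx => (hle'.2 (x := ⟨x, hx⟩) (y := x) rfl).symm)
  refine ⟨LinearMap.toSpanSingleton R W w, fun x hx => ?_⟩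
  rw [LinearMap.toSpanSingleton_apply]
  exact (hw ⟨x, hle.1 hx⟩).symm.trans (hle.2 (x := ⟨x, hx⟩) (y := ⟨x, hle.1 hx⟩) rfl).symm

instance injective_torsionSubmodule [IsNoetherianRing R] (J : Type u) [AddCommGroup J] [Module R J]
    [Module.Injective R J] : Module.Injective R (torsionSubmodule a J) := by
  refine injective_of_torsion a
    (fun w => w.2.imp fun m hm r hr => Subtype.ext (hm r hr)) fun I n g hI hg => ?_
  obtain ⟨g', hg'⟩ := Module.Injective.out (R := R) I.subtype I.injective_subtype
    ((torsionSubmodule a J).subtype ∘ₗ g)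
  refine ⟨⟨g' 1, n, fun r hr => ?_⟩, fun x => Subtype.ext ?_⟩
  · have := hg' ⟨r, hI hr⟩
    rw [LinearMap.comp_apply, hg ⟨r, hI hr⟩ hr, map_zero] at this
    rw [← map_smul, smul_eq_mul, mul_one]
    exact this
  · have := hg' x
    rw [Submodule.coe_smul, ← map_smul, smul_eq_mul, mul_one]
    exact this.symm

lemma torsionSubmodule_quotient [IsNoetherianRing R] (N : Type u) [AddCommGroup N] [Module R N] :
    torsionSubmodule a (N ⧸ torsionSubmodule a N) = ⊥ := by
  rw [eq_bot_iff]
  intro x hx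
  obtain ⟨x, rfl⟩ := Submodule.mkQ_surjective _ x
  obtain ⟨m, hm⟩ := hx
  have hfg : (Submodule.map (LinearMap.toSpanSingleton R N x) (a ^ m)).FG :=
    Submodule.FG.map _ (IsNoetherian.noetherian _)
  obtain ⟨n, hn⟩ := mem_torsionSubmodule_of_fg a hfg (by
    rintro _ ⟨r, hr, rfl⟩
    have := hm r hr
    rw [← map_smul, Submodule.mkQ_apply, Submodule.Quotient.mk_eq_zero] at this
    exact this)
  rw [Submodule.mem_bot, Submodule.mkQ_apply, Submodule.Quotient.mk_eq_zero]
  refine ⟨n + m, fun r hr => ?_⟩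
  rw [pow_add] at hr
  induction hr using Submodule.mul_induction_on' with
  | mem_mul_mem s hs t ht => rw [mul_smul]; exact hn s hs _ ⟨t, ht, rfl⟩
  | add y _ z _ hy hz => rw [add_smul, hy, hz, add_zero]

lemma lc_zero_subsingleton_iff {N : Type u} [AddCommGroup N] [Module R N] :
    Subsingleton (lc a 0 N) ↔ torsionSubmodule a N = ⊥ := by
  rw [(lcZero a).toEquiv.subsingleton_congr, Submodule.subsingleton_iff_eq_bot]

lemma injective_of_retract {J J' : Type u} [AddCommGroup J] [Module R J] [AddCommGroup J']
    [Module R J'] [Module.Injective R J] (i : J' →ₗ[R] J) (r : J →ₗ[R] J')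
    (h : r ∘ₗ i = LinearMap.id) : Module.Injective R J' where
  out X Y _ _ _ _ f hf g := by
    obtain ⟨e, he⟩ := Module.Injective.out (R := R) f hf (i ∘ₗ g)
    refine ⟨r ∘ₗ e, fun x => ?_⟩
    rw [LinearMap.comp_apply, he]
    exact LinearMap.congr_fun h (g x)

/-- A torsion-free module embeds in a torsion-free injective module. -/
theorem exists_torsionFree_injective_embedding [IsNoetherianRing R] {N : Type u} [AddCommGroup N]
    [Module R N] (hN : torsionSubmodule a N = ⊥) :
    ∃ (J : Type u) (_ : AddCommGroup J) (_ : Module R J) (i : N →ₗ[R] J),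
      Module.Injective R J ∧ torsionSubmodule a J = ⊥ ∧ Function.Injective i := by
  obtain ⟨J, _, _, i, _, hi⟩ := exists_injective_embedding R N
  obtain ⟨ρ, hρ⟩ := Module.Injective.out (R := R) (torsionSubmodule a J).subtype
    (Submodule.injective_subtype _) LinearMap.id
  have hρ' : ∀ x, ρ ((ρ x : torsionSubmodule a J) : J) = ρ x := fun x => hρ (ρ x)
  let σ : J →ₗ[R] LinearMap.ker ρ :=
    LinearMap.codRestrict _ (LinearMap.id - (torsionSubmodule a J).subtype ∘ₗ ρ) fun x => by
      simp [LinearMap.mem_ker, hρ']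
  have hσ : ∀ x, ((σ x : LinearMap.ker ρ) : J) = x - (ρ x : J) := fun x => rfl
  refine ⟨LinearMap.ker ρ, inferInstance, inferInstance, σ ∘ₗ i,
    injective_of_retract (LinearMap.ker ρ).subtype σ ?_, ?_, ?_⟩
  · ext x
    have hx : ρ (x : J) = 0 := x.2
    rw [LinearMap.comp_apply, hσ, Submodule.subtype_apply, hx, Submodule.coe_zero, sub_zero]
    rfl
  · rw [eq_bot_iff]
    intro x hx
    have h1 := map_mem_torsionSubmodule a (LinearMap.ker ρ).subtype x hx
    have h2 : ρ (x : J) = ⟨x, h1⟩ := hρ ⟨x, h1⟩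
    have h3 : ρ (x : J) = 0 := x.2
    rw [h3] at h2
    exact Subtype.ext (congrArg Subtype.val h2).symm
  · rw [injective_iff_map_eq_zero]
    intro x hx
    have h1 : i x = (ρ (i x) : J) := by
      have := congrArg Subtype.val hx
      rw [LinearMap.comp_apply, hσ] at this
      exact sub_eq_zero.1 this
    obtain ⟨m, hm⟩ := (ρ (i x)).2
    have h2 : x ∈ torsionSubmodule a N := ⟨m, fun r hr => hi (by
      rw [map_smul, map_zero, h1, hm r hr])⟩
    rwa [hN] at h2

/-- For torsion-free `N`, local cohomology is computed by shifting along an embedding into a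
torsion-free injective module. -/
theorem exists_shift [IsNoetherianRing R] {N : Type u} [AddCommGroup N] [Module R N]
    (hN : torsionSubmodule a N = ⊥) :
    ∃ (J N₁ : Type u) (_ : AddCommGroup J) (_ : Module R J) (_ : AddCommGroup N₁)
      (_ : Module R N₁) (i : N →ₗ[R] J) (q : J →ₗ[R] N₁),
      Module.Injective R J ∧ torsionSubmodule a J = ⊥ ∧ Function.Injective i ∧
        Function.Exact i q ∧ Function.Surjective q ∧
        ∀ n, Nonempty (lc a n N₁ ≃ₗ[R] lc a (n + 1) N) := by
  obtain ⟨J, _, _, i, hJ, hJ', hi⟩ := exists_torsionFree_injective_embedding a hN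
  refine ⟨J, J ⧸ LinearMap.range i, _, _, _, _, i, (LinearMap.range i).mkQ, hJ, hJ', hi,
    LinearMap.exact_map_mkQ_range i, Submodule.mkQ_surjective _, fun n => ?_⟩
  have hlc : ∀ n, Subsingleton (lc a n J)
    | 0 => (lc_zero_subsingleton_iff a).2 hJ'
    | n + 1 => lc_succ_subsingleton_of_injective a n
  have := hlc n
  have := hlc (n + 1)
  exact lc_shift a hi (LinearMap.exact_map_mkQ_range i) (Submodule.mkQ_surjective _) n

/-- Local cohomology along a weakly regular sequence contained in `a`. -/
theorem lc_of_isWeaklyRegular (rs : List R) {N : Type u} [AddCommGroup N] [Module R N]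
    (hrs : ∀ r ∈ rs, r ∈ a) (h : RingTheory.Sequence.IsWeaklyRegular N rs) :
    (∀ i < rs.length, Subsingleton (lc a i N)) ∧
      ((∀ x : N, ∃ m : ℕ, ∀ r ∈ a ^ m, r • x ∈ Ideal.ofList rs • (⊤ : Submodule R N)) →
        ∃ φ : N →ₗ[R] lc a rs.length N, LinearMap.ker φ = Ideal.ofList rs • ⊤ ∧
          ∀ w, (∀ r ∈ rs, r • w = 0) → ∃ x, φ x = w) := by
  induction rs generalizing N with
  | nil =>
    refine ⟨fun i hi => absurd hi (Nat.not_lt_zero i), fun hN => ?_⟩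
    have hN' : ∀ x : N, x ∈ torsionSubmodule a N := fun x => (hN x).imp fun m hm r hr => by
      simpa using hm r hr
    refine ⟨(lcZero a).symm.toLinearMap ∘ₗ LinearMap.codRestrict _ LinearMap.id hN', ?_,
      fun w _ => ⟨(lcZero a w : N), ?_⟩⟩
    · ext x
      simp
    · rw [LinearMap.comp_apply, LinearEquiv.coe_coe, LinearEquiv.symm_apply_eq]
      rfl
  | cons r rs ih =>
    rw [RingTheory.Sequence.isWeaklyRegular_cons_iff] at h
    obtain ⟨ih₁, ih₂⟩ := ih (fun s hs => hrs s (List.mem_cons_of_mem r hs)) h.2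
    have hexact : Function.Exact (LinearMap.lsmul R N r)
        (Submodule.mkQ (r • (⊤ : Submodule R N))) := by
      intro x
      rw [Submodule.mkQ_apply, Submodule.Quotient.mk_eq_zero,
        Submodule.mem_smul_pointwise_iff_exists]
      simp
    have hlsmul : ∀ n (x : lc a n N), lcMap a n (LinearMap.lsmul R N r) x = r • x := by
      intro n x
      have : LinearMap.lsmul R N r = r • LinearMap.id := rfl
      rw [this, lcMap_smul, lcMap_id]
      rfl
    have hinj : ∀ n, (∀ x : lc a n N, r • x = 0 → x = 0) → Subsingleton (lc a n N) := by
      intro n hn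
      rw [subsingleton_iff_forall_eq 0]
      intro x
      obtain ⟨m, hm⟩ := lc_torsion a n x
      have h1 := hm (r ^ m) (Ideal.pow_mem_pow (hrs r List.mem_cons_self) m)
      clear hm
      induction m with
      | zero => simpa using h1
      | succ m ihm =>
        rw [pow_succ', mul_smul] at h1
        exact ihm (hn _ h1)
    have hvan : ∀ i < rs.length + 1, Subsingleton (lc a i N) := by
      intro i hi
      refine hinj i fun x hx => ?_
      cases i with
      | zero =>
        refine (lcZero a).injective (Subtype.ext (h.1 ?_))
        have := congrArg (fun y => (lcZero a y : N)) hx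
        simpa using this
      | succ i =>
        obtain ⟨-, δ, -, h₂⟩ := lc_longExact a (f := LinearMap.lsmul R N r) h.1 hexact
          (Submodule.mkQ_surjective _) i
        rw [← hlsmul] at hx
        obtain ⟨y, rfl⟩ := (h₂ x).1 hx
        have : Subsingleton (lc a i (QuotSMulTop r N)) := ih₁ i (by omega)
        rw [Subsingleton.elim (α := lc a i (QuotSMulTop r N)) y 0, map_zero]
    refine ⟨hvan, fun hN => ?_⟩
    obtain ⟨-, δ, h₁, h₂⟩ := lc_longExact a (f := LinearMap.lsmul R N r) h.1 hexact
          (Submodule.mkQ_surjective _) rs.length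
    have hcomap : (Ideal.ofList rs • (⊤ : Submodule R (QuotSMulTop r N))).comap
        (Submodule.mkQ (r • (⊤ : Submodule R N))) = Ideal.ofList (r :: rs) • ⊤ := by
      rw [← Submodule.range_mkQ (r • (⊤ : Submodule R N)), ← Submodule.map_top,
        ← Submodule.map_smul'', Submodule.comap_map_mkQ, Ideal.ofList_cons_smul]
    obtain ⟨φ, hφ, hφ'⟩ := ih₂ fun x => by
      obtain ⟨x, rfl⟩ := Submodule.mkQ_surjective _ x
      refine (hN x).imp fun m hm s hs => ?_
      have := hm s hs
      rw [← hcomap, Submodule.mem_comap, map_smul] at this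
      exact this
    have hδ : LinearMap.ker δ = ⊥ := by
      rw [eq_bot_iff]
      intro x hx
      obtain ⟨y, rfl⟩ := (h₁ x).1 hx
      have := hvan rs.length (Nat.lt_succ_self _)
      rw [Subsingleton.elim y 0, map_zero]
      exact Submodule.zero_mem _
    refine ⟨δ ∘ₗ φ ∘ₗ Submodule.mkQ (r • (⊤ : Submodule R N)), ?_, fun w hw => ?_⟩
    · rw [LinearMap.ker_comp_of_ker_eq_bot _ hδ, LinearMap.ker_comp, hφ, hcomap]
    · obtain ⟨y, rfl⟩ := (h₂ w).1 (by rw [hlsmul]; exact hw r List.mem_cons_self)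
      obtain ⟨x, rfl⟩ := hφ' y fun s hs => LinearMap.ker_eq_bot.1 hδ (by
        rw [map_smul, hw s (List.mem_cons_of_mem r hs), map_zero])
      obtain ⟨x, rfl⟩ := Submodule.mkQ_surjective _ x
      exact ⟨x, rfl⟩

end Noetherian

section UpperVanishing

variable {R : Type u} [CommRing R] (a : Ideal R)

lemma torsionSubmodule_anti {a b : Ideal R} (h : ∃ k, a ^ k ≤ b) (N : Type u) [AddCommGroup N]
    [Module R N] : torsionSubmodule b N ≤ torsionSubmodule a N := by
  rintro x ⟨m, hm⟩
  obtain ⟨k, hk⟩ := h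
  exact ⟨k * m, fun r hr => hm r (Ideal.pow_right_mono hk m (pow_mul a k m ▸ hr))⟩

/-- Ideals with the same radical have the same torsion functor. -/
noncomputable def torsionFunctorIso {a b : Ideal R} (hab : ∃ k, a ^ k ≤ b) (hba : b ≤ a) :
    torsionFunctor a ≅ torsionFunctor b :=
  NatIso.ofComponents (fun N => (LinearEquiv.ofEq (torsionSubmodule a N) (torsionSubmodule b N)
    (le_antisymm (torsionSubmodule_anti ⟨1, by rwa [pow_one]⟩ N)
      (torsionSubmodule_anti hab N))).toModuleIso) (fun _ => rfl)

lemma lc_equiv_of_pow_le {a b : Ideal R} (hab : ∃ k, a ^ k ≤ b) (hba : b ≤ a) (n : ℕ)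
    (N : Type u) [AddCommGroup N] [Module R N] : Nonempty (lc a n N ≃ₗ[R] lc b n N) := by
  let e := torsionFunctorIso hab hba
  have h₁ : NatTrans.rightDerived e.hom n ≫ NatTrans.rightDerived e.inv n = 𝟙 _ := by
    rw [← NatTrans.rightDerived_comp, e.hom_inv_id, NatTrans.rightDerived_id]
  have h₂ : NatTrans.rightDerived e.inv n ≫ NatTrans.rightDerived e.hom n = 𝟙 _ := by
    rw [← NatTrans.rightDerived_comp, e.inv_hom_id, NatTrans.rightDerived_id]
  exact ⟨((Iso.mk _ _ h₁ h₂).app (ModuleCat.of R N)).toLinearEquiv⟩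

lemma exists_pow_smul_eq [IsNoetherianRing R] {J : Type u} [AddCommGroup J] [Module R J]
    [Module.Injective R J] (x : R) (n : ℕ) (v : J) (hv : v ∈ torsionSubmodule a J) :
    ∃ (k : ℕ) (w : J), w ∈ torsionSubmodule a J ∧ x ^ (k + n) • w = x ^ k • v := by
  let ann : ℕ →o Ideal R :=
    ⟨fun k => LinearMap.ker (LinearMap.toSpanSingleton R J (x ^ k • v)), by
      refine monotone_nat_of_le_succ fun k r hr => ?_
      rw [LinearMap.mem_ker, LinearMap.toSpanSingleton_apply] at hr ⊢
      rw [pow_succ', mul_smul, smul_comm, hr, smul_zero]⟩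
  obtain ⟨k, hk⟩ := monotone_stabilizes_iff_noetherian.2 (inferInstance : IsNoetherian R R) ann
  let G := torsionSubmodule a J
  let f : R →ₗ[R] R := LinearMap.toSpanSingleton R R (x ^ (k + n))
  let g : R →ₗ[R] G := LinearMap.toSpanSingleton R G (x ^ k • ⟨v, hv⟩)
  have hfg : LinearMap.ker f ≤ LinearMap.ker g := by
    intro r hr
    have h1 : r * x ^ (k + n) = 0 := hr
    have h2 : r ∈ ann (k + n) := by
      change r • x ^ (k + n) • v = 0
      rw [← mul_smul, h1, zero_smul]
    rw [← hk _ (Nat.le_add_right k n)] at h2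
    exact Subtype.ext h2
  let f' : (R ⧸ LinearMap.ker f) →ₗ[R] R := (LinearMap.ker f).liftQ f le_rfl
  obtain ⟨e, he⟩ := Module.Injective.out (R := R) (Q := G) f'
    (LinearMap.ker_eq_bot.1 (Submodule.ker_liftQ_eq_bot _ _ _ le_rfl))
    ((LinearMap.ker f).liftQ g hfg)
  refine ⟨k, e 1, (e 1).2, ?_⟩
  have h1 : e (f 1) = g 1 := he ((LinearMap.ker f).mkQ 1)
  have h2 : f 1 = x ^ (k + n) • 1 := by simp [f]
  rw [h2, map_smul] at h1
  have := congrArg Subtype.val h1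
  simpa [g] using this

/-- Adding a generator raises the cohomological dimension by at most one. -/
lemma lc_two_subsingleton_of_sup_span [IsNoetherianRing R] (x : R) {Z : Type u} [AddCommGroup Z]
    [Module R Z] [Subsingleton (lc a 1 Z)] [Subsingleton (lc a 2 Z)] :
    Subsingleton (lc (a ⊔ Ideal.span {x}) 2 Z) := by
  set b := a ⊔ Ideal.span {x} with hb
  obtain ⟨J, _, _, i, _, hi⟩ := exists_injective_embedding R Z
  let C := J ⧸ LinearMap.range i
  let q : J →ₗ[R] C := (LinearMap.range i).mkQ
  have hq : Function.Surjective q := Submodule.mkQ_surjective _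
  have hiq : Function.Exact i q := LinearMap.exact_map_mkQ_range i
  obtain ⟨J', _, _, i', _, hi'⟩ := exists_injective_embedding R C
  let q' : J' →ₗ[R] J' ⧸ LinearMap.range i' := (LinearMap.range i').mkQ
  have hq' : Function.Surjective q' := Submodule.mkQ_surjective _
  have hiq' : Function.Exact i' q' := LinearMap.exact_map_mkQ_range i'
  have hJ : ∀ (c : Ideal R) n, Subsingleton (lc c (n + 1) J) := fun c n =>
    lc_succ_subsingleton_of_injective c n
  have hJ' : ∀ (c : Ideal R) n, Subsingleton (lc c (n + 1) J') := fun c n =>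
    lc_succ_subsingleton_of_injective c n
  have hsurj : ∀ (K C : Type u) [AddCommGroup K] [Module R K] [AddCommGroup C] [Module R C]
      (p : K →ₗ[R] C), Function.Surjective (lcMap a 0 p) → ∀ c ∈ torsionSubmodule a C,
      ∃ v ∈ torsionSubmodule a K, p v = c := by
    intro K C _ _ _ _ p hp c hc
    obtain ⟨v, hv⟩ := hp ((lcZero a).symm ⟨c, hc⟩)
    refine ⟨lcZero a v, (lcZero a v).2, ?_⟩
    rw [← lcZero_lcMap, hv, LinearEquiv.apply_symm_apply]
  obtain ⟨eC⟩ : Nonempty (lc a 1 C ≃ₗ[R] lc a 2 Z) := by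
    have := hJ a 0
    have := hJ a 1
    exact lc_shift a hi hiq hq 1
  have hC : Subsingleton (lc a 1 C) := eC.toEquiv.subsingleton
  have hs₁ : Function.Surjective (lcMap a 0 q) := by
    obtain ⟨-, δ, h, -⟩ := lc_longExact a hi hiq hq 0
    exact fun y => (h y).1 (Subsingleton.elim (α := lc a 1 Z) _ _)
  have hs₂ : Function.Surjective (lcMap a 0 q') := by
    obtain ⟨-, δ, h, -⟩ := lc_longExact a hi' hiq' hq' 0
    exact fun y => (h y).1 (Subsingleton.elim (α := lc a 1 C) _ _)
  obtain ⟨eb⟩ : Nonempty (lc b 1 C ≃ₗ[R] lc b 2 Z) := by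
    have := hJ b 0
    have := hJ b 1
    exact lc_shift b hi hiq hq 1
  suffices Subsingleton (lc b 1 C) from eb.symm.toEquiv.subsingleton
  obtain ⟨-, δ, h₁, h₂⟩ := lc_longExact b hi' hiq' hq' 0
  rw [subsingleton_iff_forall_eq 0]
  intro y
  obtain ⟨z, rfl⟩ := (h₂ y).1 (by have := hJ' b 0; exact Subsingleton.elim _ _)
  refine (h₁ z).2 ?_
  obtain ⟨n, hn⟩ := (lcZero b z).2
  set c := (lcZero b z : J' ⧸ LinearMap.range i') with hc
  obtain ⟨v, hv, hvc⟩ := hsurj _ _ q' hs₂ c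
    ⟨n, fun r hr => hn r (Ideal.pow_right_mono le_sup_left n hr)⟩
  have hx : q' (x ^ n • v) = 0 := by
    rw [map_smul, hvc]
    exact hn _ (Ideal.pow_mem_pow (Ideal.mem_sup_right (Ideal.mem_span_singleton_self x)) n)
  obtain ⟨d, hd⟩ := (hiq' _).1 hx
  obtain ⟨u, hu, hud⟩ := hsurj _ _ q hs₁ d (by
    obtain ⟨m, hm⟩ := hv
    exact ⟨m, fun r hr => hi' (by rw [map_smul, hd, smul_comm, hm r hr, smul_zero, map_zero])⟩)
  obtain ⟨k, w, hw, hkw⟩ := exists_pow_smul_eq a x n u hu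
  let v' := v - i' (q w)
  have hv'c : q' v' = c := by
    rw [map_sub, hvc, (hiq' _).2 ⟨_, rfl⟩, sub_zero]
  have hv'x : x ^ (k + n) • v' = 0 := by
    rw [smul_sub, ← map_smul, ← map_smul, hkw, map_smul, map_smul, hud, hd, ← mul_smul, ← pow_add,
      sub_self]
  have hv'a : v' ∈ torsionSubmodule a J' := sub_mem hv
    (map_mem_torsionSubmodule a i' _ (map_mem_torsionSubmodule a q w hw))
  have hv'b : v' ∈ torsionSubmodule b J' := by
    obtain ⟨m, hm⟩ := hv'a
    refine ⟨m + (k + n), fun r hr => ?_⟩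
    obtain ⟨s, hs, t, ht, rfl⟩ := Submodule.mem_sup.1 (Ideal.sup_pow_add_le_pow_sup_pow hr)
    rw [Ideal.span_singleton_pow, Ideal.mem_span_singleton'] at ht
    obtain ⟨t, rfl⟩ := ht
    rw [add_smul, hm s hs, mul_smul, hv'x, smul_zero, add_zero]
  refine ⟨(lcZero b).symm ⟨v', hv'b⟩, (lcZero b).injective (Subtype.ext ?_)⟩
  rw [lcZero_lcMap, LinearEquiv.apply_symm_apply]
  exact hv'c

/-- Every module has an `n`-th cosyzygy, which shifts local cohomology for every ideal. -/
lemma exists_cosyzygy (n : ℕ) (N : Type u) [AddCommGroup N] [Module R N] :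
    ∃ (Z : Type u) (_ : AddCommGroup Z) (_ : Module R Z),
      ∀ (b : Ideal R) (i : ℕ), Nonempty (lc b (i + 1) Z ≃ₗ[R] lc b (i + 1 + n) N) := by
  induction n with
  | zero => exact ⟨N, inferInstance, inferInstance, fun b i => ⟨LinearEquiv.refl R _⟩⟩
  | succ n ih =>
    obtain ⟨Z, _, _, hZ⟩ := ih
    obtain ⟨J, _, _, f, _, hf⟩ := exists_injective_embedding R Z
    refine ⟨J ⧸ LinearMap.range f, inferInstance, inferInstance, fun b i => ?_⟩
    have := lc_succ_subsingleton_of_injective b i (N := J)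
    have := lc_succ_subsingleton_of_injective b (i + 1) (N := J)
    obtain ⟨e⟩ := lc_shift b hf (LinearMap.exact_map_mkQ_range f) (Submodule.mkQ_surjective _)
      (i + 1)
    obtain ⟨e'⟩ := hZ b (i + 1)
    rw [show i + 1 + (n + 1) = i + 1 + 1 + n by omega]
    exact ⟨e.trans e'⟩

/-- Local cohomology vanishes above the number of generators. -/
theorem lc_subsingleton_of_length_lt [IsNoetherianRing R] (l : List R) (i : ℕ)
    (hi : l.length < i) (N : Type u) [AddCommGroup N] [Module R N] :
    Subsingleton (lc (Ideal.ofList l) i N) := by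
  induction l generalizing i N with
  | nil =>
    obtain ⟨J, _, _, f, _, hf⟩ := exists_injective_embedding R N
    have htop : ∀ (N : Type u) [AddCommGroup N] [Module R N] (x : N),
        x ∈ torsionSubmodule (Ideal.ofList ([] : List R)) N := fun N _ _ x => ⟨1, by simp⟩
    induction i generalizing N J with
    | zero => exact absurd hi (Nat.not_lt_zero _)
    | succ i ih =>
      obtain ⟨-, δ, h₁, h₂⟩ := lc_longExact (Ideal.ofList ([] : List R)) hf
        (LinearMap.exact_map_mkQ_range f) (Submodule.mkQ_surjective _) i
      have := lc_succ_subsingleton_of_injective (Ideal.ofList ([] : List R)) i (N := J)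
      rw [subsingleton_iff_forall_eq 0]
      intro y
      obtain ⟨z, rfl⟩ := (h₂ y).1 (Subsingleton.elim _ _)
      refine (h₁ z).2 ?_
      cases i with
      | zero =>
        obtain ⟨v, hv⟩ := Submodule.mkQ_surjective _
          (lcZero (Ideal.ofList ([] : List R)) z : J ⧸ LinearMap.range f)
        refine ⟨(lcZero _).symm ⟨v, htop J v⟩, (lcZero _).injective (Subtype.ext ?_)⟩
        rw [lcZero_lcMap, LinearEquiv.apply_symm_apply]
        exact hv
      | succ i =>
        obtain ⟨J', _, _, f', hJ', hf'⟩ := exists_injective_embedding R (J ⧸ LinearMap.range f)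
        have := ih (Nat.succ_pos _) (J ⧸ LinearMap.range f) J' _ _ f' hJ' hf'
        exact ⟨0, Subsingleton.elim _ _⟩
  | cons x l ih =>
    obtain ⟨j, rfl⟩ : ∃ j, i = 1 + 1 + j := ⟨i - 2, by simp at hi; omega⟩
    simp only [List.length_cons] at hi
    obtain ⟨Z, _, _, hZ⟩ := exists_cosyzygy (R := R) j N
    have h₁ : Subsingleton (lc (Ideal.ofList l) 1 Z) := by
      have := ih (0 + 1 + j) (by omega) N
      exact (hZ (Ideal.ofList l) 0).some.toEquiv.subsingleton
    have h₂ : Subsingleton (lc (Ideal.ofList l) 2 Z) := by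
      have := ih (1 + 1 + j) (by omega) N
      exact (hZ (Ideal.ofList l) 1).some.toEquiv.subsingleton
    have h₃ := lc_two_subsingleton_of_sup_span (Ideal.ofList l) x (Z := Z)
    rw [Ideal.ofList_cons, sup_comm]
    exact (hZ _ 1).some.symm.toEquiv.subsingleton

end UpperVanishing

section ExtVanishing

variable {R : Type u} [CommRing R]

/-- `Ext^n_R(M, N) = 0`. -/
abbrev ExtVanishes (R : Type u) [CommRing R] (M N : Type u) [AddCommGroup M] [Module R M]
    [AddCommGroup N] [Module R N] (n : ℕ) : Prop :=
  Subsingleton (Abelian.Ext (ModuleCat.of R M) (ModuleCat.of R N) n)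

variable {L N N' N'' : Type u} [AddCommGroup L] [Module R L] [AddCommGroup N] [Module R N]
  [AddCommGroup N'] [Module R N'] [AddCommGroup N''] [Module R N'']

lemma extVanishes_zero_iff : ExtVanishes R L N 0 ↔ ∀ f : L →ₗ[R] N, f = 0 := by
  rw [ExtVanishes, Abelian.Ext.homEquiv₀.subsingleton_congr]
  refine ⟨fun h f => ?_, fun h => ⟨fun f g => ?_⟩⟩
  · exact congrArg ModuleCat.Hom.hom (Subsingleton.elim (ModuleCat.ofHom f) 0)
  · exact ModuleCat.hom_ext ((h f.hom).trans (h g.hom).symm)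

lemma extVanishes_of_injective [Module.Injective R N] (n : ℕ) : ExtVanishes R L N (n + 1) := by
  have : Injective (ModuleCat.of R N) := Module.injective_object_of_injective_module R N
  exact subsingleton_of_forall_eq 0 fun x => Abelian.Ext.eq_zero_of_injective x

lemma extVanishes_congr_left {L' : Type u} [AddCommGroup L'] [Module R L'] (e : L ≃ₗ[R] L') (n : ℕ)
    (h : ExtVanishes R L N n) : ExtVanishes R L' N n := by
  refine subsingleton_of_forall_eq 0 fun x => ?_
  have h1 : (Abelian.Ext.mk₀ e.toModuleIso.inv).comp ((Abelian.Ext.mk₀ e.toModuleIso.hom).comp x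
      (zero_add n)) (zero_add n) = x := by
    rw [Abelian.Ext.mk₀_comp_mk₀_assoc, Iso.inv_hom_id, Abelian.Ext.mk₀_id_comp]
  rw [← h1, Subsingleton.elim (α := Abelian.Ext (ModuleCat.of R L) (ModuleCat.of R N) n)
    ((Abelian.Ext.mk₀ e.toModuleIso.hom).comp x _) 0, Abelian.Ext.comp_zero]

lemma extVanishes_congr_right (e : N ≃ₗ[R] N') (n : ℕ)
    (h : ExtVanishes R L N n) : ExtVanishes R L N' n := by
  refine subsingleton_of_forall_eq 0 fun x => ?_
  have h1 : (x.comp (Abelian.Ext.mk₀ e.toModuleIso.inv) (add_zero n)).comp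
      (Abelian.Ext.mk₀ e.toModuleIso.hom) (add_zero n) = x := by
    rw [Abelian.Ext.comp_assoc_of_third_deg_zero, Abelian.Ext.mk₀_comp_mk₀, Iso.inv_hom_id,
      Abelian.Ext.comp_mk₀_id]
  rw [← h1, Subsingleton.elim (α := Abelian.Ext (ModuleCat.of R L) (ModuleCat.of R N) n)
    (x.comp (Abelian.Ext.mk₀ e.toModuleIso.inv) _) 0, Abelian.Ext.zero_comp]

section ShortExact

variable {f : N →ₗ[R] N'} {g : N' →ₗ[R] N''} (hf : Function.Injective f)
    (hfg : Function.Exact f g) (hg : Function.Surjective g)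

include hf hfg hg

lemma exists_shortExact :
    ∃ w, (ShortComplex.mk (ModuleCat.ofHom f) (ModuleCat.ofHom g) w).ShortExact :=
  ⟨ModuleCat.hom_ext hfg.linearMap_comp_eq_zero,
    ModuleCat.shortComplex_shortExact (ModuleCat.shortComplexOfCompEqZero f g
      hfg.linearMap_comp_eq_zero) hfg hf hg⟩

lemma extVanishes_quotient {n : ℕ} (h₁ : ExtVanishes R L N (n + 1)) (h₂ : ExtVanishes R L N' n) :
    ExtVanishes R L N'' n := by
  obtain ⟨w, hS⟩ := exists_shortExact hf hfg hg
  refine subsingleton_of_forall_eq 0 fun x => ?_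
  obtain ⟨y, rfl⟩ := Abelian.Ext.covariant_sequence_exact₃ _ hS x rfl (h₁.elim _ _)
  rw [h₂.elim y 0, Abelian.Ext.zero_comp]

lemma extVanishes_sub {n : ℕ} (h₁ : ExtVanishes R L N'' n) (h₂ : ExtVanishes R L N' (n + 1)) :
    ExtVanishes R L N (n + 1) := by
  obtain ⟨w, hS⟩ := exists_shortExact hf hfg hg
  refine subsingleton_of_forall_eq 0 fun x => ?_
  obtain ⟨y, rfl⟩ := Abelian.Ext.covariant_sequence_exact₁ _ hS x (h₂.elim _ _) rfl
  rw [h₁.elim y 0, Abelian.Ext.zero_comp]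

lemma exists_lift_of_extVanishes (h : ExtVanishes R L N 1) (φ : L →ₗ[R] N'') :
    ∃ ψ : L →ₗ[R] N', g ∘ₗ ψ = φ := by
  obtain ⟨w, hS⟩ := exists_shortExact hf hfg hg
  obtain ⟨y, hy⟩ := Abelian.Ext.covariant_sequence_exact₃ (ModuleCat.of R L) hS
    (Abelian.Ext.mk₀ (ModuleCat.ofHom φ)) rfl (h.elim _ _)
  obtain ⟨ψ, rfl⟩ := (Abelian.Ext.mk₀_bijective _ _).2 y
  rw [Abelian.Ext.mk₀_comp_mk₀] at hy
  exact ⟨ψ.hom, congrArg ModuleCat.Hom.hom ((Abelian.Ext.mk₀_bijective _ _).1 hy)⟩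

lemma extVanishes_left_middle {n : ℕ} (h₁ : ExtVanishes R N L n) (h₂ : ExtVanishes R N'' L n) :
    ExtVanishes R N' L n := by
  obtain ⟨w, hS⟩ := exists_shortExact hf hfg hg
  refine subsingleton_of_forall_eq 0 fun x => ?_
  obtain ⟨y, rfl⟩ := Abelian.Ext.contravariant_sequence_exact₂ hS _ x (h₁.elim _ _)
  rw [h₂.elim y 0, Abelian.Ext.comp_zero]

lemma extVanishes_left_sub {n : ℕ} (h₁ : ExtVanishes R N'' L (1 + n)) (h₂ : ExtVanishes R N' L n) :
    ExtVanishes R N L n := by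
  obtain ⟨w, hS⟩ := exists_shortExact hf hfg hg
  refine subsingleton_of_forall_eq 0 fun x => ?_
  obtain ⟨y, rfl⟩ := Abelian.Ext.contravariant_sequence_exact₁ hS _ x rfl (h₁.elim _ _)
  rw [h₂.elim y 0, Abelian.Ext.comp_zero]

lemma exists_extension_of_extVanishes (h : ExtVanishes R N'' L 1) (φ : N →ₗ[R] L) :
    ∃ ψ : N' →ₗ[R] L, ψ ∘ₗ f = φ := by
  obtain ⟨w, hS⟩ := exists_shortExact hf hfg hg
  obtain ⟨y, hy⟩ := Abelian.Ext.contravariant_sequence_exact₁ hS (ModuleCat.of R L)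
    (Abelian.Ext.mk₀ (ModuleCat.ofHom φ)) rfl (h.elim _ _)
  obtain ⟨ψ, rfl⟩ := (Abelian.Ext.mk₀_bijective _ _).2 y
  rw [Abelian.Ext.mk₀_comp_mk₀] at hy
  exact ⟨ψ.hom, congrArg ModuleCat.Hom.hom ((Abelian.Ext.mk₀_bijective _ _).1 hy)⟩

end ShortExact

end ExtVanishing

section Hom

variable {R : Type u} [CommRing R] (a : Ideal R)

/-- For finitely generated `D`, the torsion of `Hom(D, N)` is `Hom(D, Γ N)`. -/
lemma mem_torsionSubmodule_hom_iff {D N : Type u} [AddCommGroup D] [Module R D]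
    [Module.Finite R D] [AddCommGroup N] [Module R N] (f : D →ₗ[R] N) :
    f ∈ torsionSubmodule a (D →ₗ[R] N) ↔ ∀ d, f d ∈ torsionSubmodule a N := by
  refine ⟨fun ⟨m, hm⟩ d => ⟨m, fun r hr => LinearMap.congr_fun (hm r hr) d⟩, fun h => ?_⟩
  obtain ⟨m, hm⟩ := mem_torsionSubmodule_of_fg a (P := LinearMap.range f)
    (by rw [LinearMap.range_eq_map]; exact Module.Finite.fg_top.map f)
    (by rintro _ ⟨d, rfl⟩; exact h d)
  exact ⟨m, fun r hr => LinearMap.ext fun d => hm r hr _ ⟨d, rfl⟩⟩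

lemma torsionSubmodule_hom_eq_bot {D N : Type u} [AddCommGroup D] [Module R D]
    [AddCommGroup N] [Module R N] (hN : torsionSubmodule a N = ⊥) :
    torsionSubmodule a (D →ₗ[R] N) = ⊥ := by
  rw [eq_bot_iff]
  rintro f ⟨m, hm⟩
  refine LinearMap.ext fun d => ?_
  have : f d ∈ torsionSubmodule a N := ⟨m, fun r hr => LinearMap.congr_fun (hm r hr) d⟩
  rwa [hN] at this

lemma injective_hom_of_flat {Q J : Type u} [AddCommGroup Q] [Module R Q] [Module.Flat R Q]
    [AddCommGroup J] [Module R J] [Module.Injective R J] : Module.Injective R (Q →ₗ[R] J) where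
  out X Y _ _ _ _ f hf g := by
    obtain ⟨e, he⟩ := Module.Injective.out (R := R) (f.lTensor Q)
      (Module.Flat.lTensor_preserves_injective_linearMap f hf) (TensorProduct.lift g.flip)
    refine ⟨(TensorProduct.curry e).flip, fun x => LinearMap.ext fun q => ?_⟩
    simpa using he (q ⊗ₜ x)

/-- `Hom(D, J)` is acyclic for local cohomology if `D` is finitely generated and `J` injective. -/
theorem lc_hom_injective [IsNoetherianRing R] {D J : Type u} [AddCommGroup D] [Module R D]
    [Module.Finite R D] [AddCommGroup J] [Module R J] [Module.Injective R J] (n : ℕ) :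
    Subsingleton (lc a (n + 1) (D →ₗ[R] J)) := by
  induction n using Nat.strong_induction_on generalizing D with | _ n ih
  obtain ⟨m, f, hf⟩ := Module.Finite.exists_fin' R D
  let K := LinearMap.ker f
  have h₁ : Function.Injective (LinearMap.lcomp R J f) :=
    LinearMap.lcomp_injective_of_surjective f hf
  have h₂ : Function.Exact (LinearMap.lcomp R J f) (LinearMap.lcomp R J K.subtype) :=
    LinearMap.exact_lcomp_of_exact_of_surjective J (LinearMap.exact_subtype_ker_map f) hf
  have h₃ : Function.Surjective (LinearMap.lcomp R J K.subtype) := fun g => by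
    obtain ⟨e, he⟩ := Module.Injective.out (R := R) K.subtype K.injective_subtype g
    exact ⟨e, LinearMap.ext he⟩
  have hinj : Module.Injective R ((Fin m → R) →ₗ[R] J) := injective_hom_of_flat
  obtain ⟨-, δ, hδ₁, hδ₂⟩ := lc_longExact a h₁ h₂ h₃ n
  have := lc_succ_subsingleton_of_injective a n (N := (Fin m → R) →ₗ[R] J)
  refine subsingleton_of_forall_eq 0 fun x => ?_
  obtain ⟨y, rfl⟩ := (hδ₂ x).1 (Subsingleton.elim _ _)
  refine (hδ₁ y).2 ?_
  cases n with
  | succ n => exact ⟨0, (ih n n.lt_succ_self (D := K)).elim _ _⟩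
  | zero =>
    have hg := (mem_torsionSubmodule_hom_iff a _).1 (lcZero a y).2
    obtain ⟨e, he⟩ := Module.Injective.out (R := R) K.subtype K.injective_subtype
      (LinearMap.codRestrict _ _ hg)
    have he' : (torsionSubmodule a J).subtype ∘ₗ e ∈ torsionSubmodule a ((Fin m → R) →ₗ[R] J) :=
      (mem_torsionSubmodule_hom_iff a _).2 fun d => (e d).2
    refine ⟨(lcZero a).symm ⟨_, he'⟩, (lcZero a).injective (Subtype.ext ?_)⟩
    rw [lcZero_lcMap, LinearEquiv.apply_symm_apply]
    exact LinearMap.ext fun d => congrArg Subtype.val (he d)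

/-- If the lower local cohomology of `N` and the lower `Ext(D, N)` vanish, then local cohomology
commutes with `Hom(D, -)` in the first nonvanishing degree. -/
theorem lc_hom_equiv [IsNoetherianRing R] {D : Type u} [AddCommGroup D] [Module R D]
    [Module.Finite R D] (t : ℕ) {N : Type u} [AddCommGroup N] [Module R N]
    (hN : ∀ i < t, Subsingleton (lc a i N)) (hext : ∀ i, 1 ≤ i → i ≤ t → ExtVanishes R D N i) :
    Nonempty (lc a t (D →ₗ[R] N) ≃ₗ[R] (D →ₗ[R] lc a t N)) := by
  induction t generalizing N with
  | zero =>
    let e : torsionSubmodule a (D →ₗ[R] N) ≃ₗ[R] (D →ₗ[R] torsionSubmodule a N) :=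
      { toFun := fun f => LinearMap.codRestrict _ f.1 ((mem_torsionSubmodule_hom_iff a _).1 f.2)
        invFun := fun g => ⟨(torsionSubmodule a N).subtype ∘ₗ g,
          (mem_torsionSubmodule_hom_iff a _).2 fun d => (g d).2⟩
        map_add' := fun _ _ => rfl
        map_smul' := fun _ _ => rfl
        left_inv := fun _ => rfl
        right_inv := fun _ => rfl }
    exact ⟨lcZero a ≪≫ₗ e ≪≫ₗ (LinearEquiv.refl R D).arrowCongr (lcZero a).symm⟩
  | succ t ih =>
    obtain ⟨J, N₁, _, _, _, _, i, q, _, hJ, hi, hiq, hq, hshift⟩ := exists_shift a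
      ((lc_zero_subsingleton_iff a).1 (hN 0 t.succ_pos))
    have h₁ : Function.Injective (LinearMap.compRight R i : (D →ₗ[R] N) →ₗ[R] (D →ₗ[R] J)) :=
      fun f g h => LinearMap.ext fun d => hi (LinearMap.congr_fun h d)
    have h₂ : Function.Exact (LinearMap.compRight R i : (D →ₗ[R] N) →ₗ[R] (D →ₗ[R] J))
        (LinearMap.compRight R q : (D →ₗ[R] J) →ₗ[R] (D →ₗ[R] N₁)) := by
      intro f
      constructor
      · intro h
        let e := LinearEquiv.ofInjective i hi
        refine ⟨e.symm.toLinearMap ∘ₗ LinearMap.codRestrict _ f fun d =>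
          (hiq _).1 (LinearMap.congr_fun h d), LinearMap.ext fun d => ?_⟩
        exact congrArg Subtype.val (e.apply_symm_apply _)
      · rintro ⟨g, rfl⟩
        exact LinearMap.ext fun d => (hiq _).2 ⟨g d, rfl⟩
    have h₃ : Function.Surjective (LinearMap.compRight R q : (D →ₗ[R] J) →ₗ[R] (D →ₗ[R] N₁)) :=
      exists_lift_of_extVanishes hi hiq hq (hext 1 le_rfl (Nat.succ_pos t))
    have hz : ∀ n, Subsingleton (lc a n (D →ₗ[R] J))
      | 0 => (lc_zero_subsingleton_iff a).2 (torsionSubmodule_hom_eq_bot a hJ)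
      | n + 1 => lc_hom_injective a n
    have := hz t
    have := hz (t + 1)
    obtain ⟨e₁⟩ := lc_shift a h₁ h₂ h₃ t
    obtain ⟨e₂⟩ := ih (N := N₁)
      (fun i hit => by
        have := hN (i + 1) (by omega)
        exact (hshift i).some.toEquiv.subsingleton)
      (fun i h1 h2 => by
        obtain ⟨i, rfl⟩ := Nat.exists_eq_add_of_le' h1
        exact extVanishes_quotient hi hiq hq (hext (i + 2) (by omega) (by omega))
          (extVanishes_of_injective i))
    exact ⟨e₁.symm ≪≫ₗ e₂ ≪≫ₗ (LinearEquiv.refl R D).arrowCongr (hshift t).some⟩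

/-- If the lower local cohomology of `N` and `Ext^{t+1}(L, N)` vanish for a finitely generated
torsion module `L`, then `Ext^1(L, H^t(N)) = 0`. -/
theorem extVanishes_one_lc [IsNoetherianRing R] {L : Type u} [AddCommGroup L] [Module R L]
    (hL : ∀ x : L, ∃ m : ℕ, ∀ r ∈ a ^ m, r • x = 0) (t : ℕ)
    {N : Type u} [AddCommGroup N] [Module R N] (hN : ∀ i < t, Subsingleton (lc a i N))
    (hext : ExtVanishes R L N (t + 1)) : ExtVanishes R L (lc a t N) 1 := by
  induction t generalizing N with
  | zero =>
    have hΓ : ExtVanishes R L (torsionSubmodule a N) 1 := by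
      refine extVanishes_sub (torsionSubmodule a N).injective_subtype
        (LinearMap.exact_subtype_mkQ _) (Submodule.mkQ_surjective _) ?_ hext
      rw [extVanishes_zero_iff]
      intro f
      refine LinearMap.ext fun x => ?_
      obtain ⟨m, hm⟩ := hL x
      have : f x ∈ torsionSubmodule a (N ⧸ torsionSubmodule a N) :=
        ⟨m, fun r hr => by rw [← map_smul, hm r hr, map_zero]⟩
      rwa [torsionSubmodule_quotient] at this
    exact extVanishes_congr_right (lcZero a).symm 1 hΓ
  | succ t ih =>
    obtain ⟨J, N₁, _, _, _, _, i, q, _, hJ, hi, hiq, hq, hshift⟩ := exists_shift a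
      ((lc_zero_subsingleton_iff a).1 (hN 0 t.succ_pos))
    refine extVanishes_congr_right (hshift t).some 1 (ih (fun i hit => ?_) ?_)
    · have := hN (i + 1) (by omega)
      exact (hshift i).some.toEquiv.subsingleton
    · exact extVanishes_quotient hi hiq hq hext (extVanishes_of_injective t)

end Hom

section LocalDuality

open IsLocalRing

lemma exists_socle_multiple {R : Type u} [CommRing R] {a : Ideal R} {W : Type u} [AddCommGroup W]
    [Module R W] {w : W} (hw : w ≠ 0) (h : ∃ m : ℕ, ∀ r ∈ a ^ m, r • w = 0) :
    ∃ r : R, r • w ≠ 0 ∧ ∀ s ∈ a, s • r • w = 0 := by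
  classical
  have h0 : Nat.find h ≠ 0 := fun h0 => hw (by
    have := Nat.find_spec h
    rw [h0] at this
    simpa using this 1 (by simp))
  obtain ⟨k, hk⟩ := Nat.exists_eq_succ_of_ne_zero h0
  have hk' := Nat.find_min h (m := k) (by omega)
  push Not at hk'
  obtain ⟨r, hr, hrw⟩ := hk'
  refine ⟨r, hrw, fun s hs => ?_⟩
  rw [← mul_smul]
  refine Nat.find_spec h _ ?_
  rw [hk, pow_succ']
  exact Ideal.mul_mem_mul hs hr

variable {A : Type u} [CommRing A] [IsLocalRing A]

lemma exists_residueField_embedding {W : Type u} [AddCommGroup W] [Module A W] {w : W}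
    (hw : w ≠ 0) (h : ∀ s ∈ maximalIdeal A, s • w = 0) :
    ∃ f : (A ⧸ maximalIdeal A) →ₗ[A] W, Function.Injective f ∧ ∀ r : A,
      f (Submodule.Quotient.mk r) = r • w := by
  have hle : maximalIdeal A ≤ LinearMap.ker (LinearMap.toSpanSingleton A W w) := fun s hs => h s hs
  have hker : LinearMap.ker (LinearMap.toSpanSingleton A W w) ≤ maximalIdeal A := by
    refine le_maximalIdeal fun htop => hw ?_
    have : (1 : A) ∈ LinearMap.ker (LinearMap.toSpanSingleton A W w) := htop ▸ trivial
    simpa using this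
  exact ⟨(maximalIdeal A).liftQ _ hle,
    LinearMap.ker_eq_bot.1 (Submodule.ker_liftQ_eq_bot _ _ _ hker), fun _ => rfl⟩

lemma exists_hom_ne_zero (D : Type u) [AddCommGroup D] [Module A D] [Module.Finite A D]
    [Nontrivial D] {W : Type u} [AddCommGroup W] [Module A W] {w : W} (hw : w ≠ 0)
    (h : ∀ s ∈ maximalIdeal A, s • w = 0) :
    ∃ g : D →ₗ[A] W, g ≠ 0 ∧ (∀ d, ∃ r : A, g d = r • w) ∧ ∀ s ∈ maximalIdeal A, s • g = 0 := by
  obtain ⟨P, hP⟩ := IsCoatomic.exists_coatom (Submodule A D)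
  have := isSimpleModule_iff_isCoatom.2 hP
  obtain ⟨I, hI, ⟨e⟩⟩ := isSimpleModule_iff_quot_maximal.1 this
  obtain rfl := IsLocalRing.eq_maximalIdeal hI
  obtain ⟨f, hf, hf'⟩ := exists_residueField_embedding hw h
  have hg : ∀ d, ∃ r : A, (f ∘ₗ e.toLinearMap ∘ₗ P.mkQ) d = r • w := fun d => by
    obtain ⟨r, hr⟩ := Submodule.Quotient.mk_surjective _ (e (P.mkQ d))
    exact ⟨r, by rw [← hf', hr]; rfl⟩
  refine ⟨f ∘ₗ e.toLinearMap ∘ₗ P.mkQ, fun h0 => hP.1 ?_, hg, fun s hs => ?_⟩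
  · rw [eq_top_iff]
    intro d _
    have : f (e (P.mkQ d)) = f 0 := by rw [map_zero]; exact LinearMap.congr_fun h0 d
    have := e.injective ((hf this).trans (map_zero e).symm)
    rwa [Submodule.mkQ_apply, Submodule.Quotient.mk_eq_zero] at this
  · refine LinearMap.ext fun d => ?_
    obtain ⟨r, hr⟩ := hg d
    rw [LinearMap.smul_apply, hr, smul_comm, h s hs, smul_zero, LinearMap.zero_apply]

variable [IsNoetherianRing A] {rs : List A} (hrs : ∀ r ∈ rs, r ∈ maximalIdeal A)
  (hreg : RingTheory.Sequence.IsRegular A rs)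
  (hlen : (rs.length : WithBot ℕ∞) = ringKrullDim A)

include hreg hlen in
lemma exists_pow_le_ofList : ∃ k, maximalIdeal A ^ k ≤ Ideal.ofList rs := by
  have hdim := ringKrullDim_add_length_eq_ringKrullDim_of_isRegular rs hreg
  rw [← hlen] at hdim
  have hle : ringKrullDim (A ⧸ Ideal.ofList rs) ≤ (0 : ℕ) := by
    have h1 : ringKrullDim (A ⧸ Ideal.ofList rs) + rs.length ≤
        (0 : ℕ) + (rs.length : WithBot ℕ∞) := by
      rw [hdim]; simp
    exact (ENat.WithBot.add_le_add_natCast_right_iff).1 h1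
  have hz := Ring.krullDimLE_zero_iff.1 (Ring.krullDimLE_iff.2 hle)
  refine Ideal.exists_pow_le_of_le_radical_of_fg ?_ (IsNoetherian.noetherian _)
  rw [Ideal.radical_eq_sInf]
  refine le_sInf fun J ⟨hJ, hJ'⟩ => ?_
  have : (J.map (Ideal.Quotient.mk (Ideal.ofList rs))).IsPrime :=
    Ideal.map_isPrime_of_surjective Ideal.Quotient.mk_surjective (by rwa [Ideal.mk_ker])
  have hmax := Ideal.comap_isMaximal_of_surjective (Ideal.Quotient.mk (Ideal.ofList rs))
    Ideal.Quotient.mk_surjective (H := hz _ this)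
  rw [Ideal.comap_map_of_surjective' _ Ideal.Quotient.mk_surjective, Ideal.mk_ker,
    sup_eq_left.2 hJ] at hmax
  exact (IsLocalRing.eq_maximalIdeal hmax).ge

include hreg hlen in
/-- A module of finite injective dimension has no `Ext` from torsion modules above `dim A`. -/
theorem extVanishes_of_length_lt {D : Type u} [AddCommGroup D] [Module A D] {n : ℕ}
    (hD : HasInjectiveDimensionLE (ModuleCat.of A D) n) (i : ℕ) (hi : rs.length < i)
    (L : Type u) [AddCommGroup L] [Module A L] [hLf : Module.Finite A L]
    (hL : ∀ x : L, ∃ k : ℕ, ∀ r ∈ maximalIdeal A ^ k, r • x = 0) : ExtVanishes A L D i := by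
  obtain ⟨j, hj⟩ : ∃ j, n + 1 ≤ i + j := ⟨n + 1, by omega⟩
  induction j generalizing i L with
  | zero => exact HasInjectiveDimensionLT.subsingleton _ (n + 1) i hj _
  | succ j ih =>
    have hres : ExtVanishes A (A ⧸ maximalIdeal A) D i := by
      obtain ⟨k, hk⟩ := exists_pow_le_ofList hreg hlen
      have htor : ∀ x : A ⧸ Ideal.ofList rs, ∃ k : ℕ, ∀ r ∈ maximalIdeal A ^ k, r • x = 0 := by
        intro x
        obtain ⟨x, rfl⟩ := Submodule.Quotient.mk_surjective _ x
        refine ⟨k, fun r hr => (Submodule.Quotient.mk_eq_zero _).2 ?_⟩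
        exact Ideal.mul_mem_right _ _ (hk hr)
      have hne : (1 : A ⧸ Ideal.ofList rs) ≠ 0 := by
        intro h
        refine hreg.top_ne_smul ?_
        have : Ideal.ofList rs = ⊤ :=
          (Ideal.eq_top_iff_one _).2 (Ideal.Quotient.eq_zero_iff_mem.1 h)
        simp [this]
      obtain ⟨r, hr, hr'⟩ := exists_socle_multiple hne (htor 1)
      obtain ⟨f, hf, -⟩ := exists_residueField_embedding hr hr'
      refine extVanishes_left_sub hf (LinearMap.exact_map_mkQ_range f)
        (Submodule.mkQ_surjective _) ?_ ?_
      · rw [add_comm]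
        refine ih (i + 1) (by omega) _ (fun x => ?_) (by omega)
        obtain ⟨x, rfl⟩ := Submodule.Quotient.mk_surjective _ x
        exact (htor x).imp fun k hk r hr => by
          rw [← Submodule.Quotient.mk_smul, hk r hr, Submodule.Quotient.mk_zero]
      · have hpd : HasProjectiveDimensionLE (ModuleCat.of A (A ⧸ Ideal.ofList rs)) rs.length := by
          rw [← projectiveDimension_le_iff, projectiveDimension_eq_of_iso
            (Shrink.linearEquiv A (A ⧸ Ideal.ofList rs)).symm.toModuleIso]
          exact (ModuleCat.projectiveDimension_quotient_eq_length rs hreg).le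
        exact HasProjectiveDimensionLT.subsingleton _ (rs.length + 1) i hi _
    clear ih
    induction hLf using IsNoetherianRing.induction_on_isQuotientEquivQuotientPrime A with
    | subsingleton N =>
      have hN : Limits.IsZero (ModuleCat.of A N) := ModuleCat.isZero_of_subsingleton _
      have := hN.hasProjectiveDimensionLT_zero
      exact HasProjectiveDimensionLT.subsingleton _ 0 i (Nat.zero_le i) _
    | quotient N p e =>
      have hp : p.1 = maximalIdeal A := by
        refine le_antisymm (le_maximalIdeal p.2.ne_top) ?_
        obtain ⟨k, hk⟩ := hL (e.symm (Submodule.Quotient.mk 1))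
        refine Ideal.IsPrime.le_of_pow_le (n := k) fun r hr => ?_
        have := congrArg e (hk r hr)
        rw [map_smul, e.apply_symm_apply, map_zero, ← Submodule.Quotient.mk_smul,
          Submodule.Quotient.mk_eq_zero, smul_eq_mul, mul_one] at this
        exact this
      rw [hp] at e
      exact extVanishes_congr_left e.symm i hres
    | exact N₁ N₂ N₃ f g hf hg hfg h₁ h₃ =>
      refine extVanishes_left_middle hf hfg hg (h₁ fun x => ?_) (h₃ fun x => ?_)
      · exact (hL (f x)).imp fun k hk r hr => hf (by rw [map_smul, hk r hr, map_zero])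
      · obtain ⟨x, rfl⟩ := hg x
        exact (hL x).imp fun k hk r hr => by rw [← map_smul, hk r hr, map_zero]

section Dualizing

variable {D : Type u} [AddCommGroup D] [Module A D] (hD : IsDualizing A D)

omit [IsNoetherianRing A] in
include hD in
lemma IsDualizing.nontrivial : Nontrivial D := by
  by_contra h
  rw [not_nontrivial_iff_subsingleton] at h
  have := hD.homothety_bijective.1 (Subsingleton.elim (LinearMap.lsmul A D 1)
    (LinearMap.lsmul A D 0))
  exact one_ne_zero this

include hrs hreg hD in
lemma lc_dualizing_subsingleton (i : ℕ) (hi : i < rs.length) :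
    Subsingleton (lc (maximalIdeal A) i D) := by
  induction i using Nat.strong_induction_on with | _ i ih
  have := hD.finite
  have := hD.nontrivial
  obtain ⟨e⟩ := lc_hom_equiv (maximalIdeal A) (D := D) (N := D) i
    (fun j hj => ih j hj (hj.trans hi)) (fun j hj _ => hD.ext_vanishing j hj)
  have h₁ := (lc_of_isWeaklyRegular (maximalIdeal A) rs hrs hreg.toIsWeaklyRegular).1 i hi
  have h₂ : Subsingleton (D →ₗ[A] lc (maximalIdeal A) i D) := by
    let e' := lcCongr (maximalIdeal A) i (LinearEquiv.ofBijective _ hD.homothety_bijective)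
    exact (e'.trans e).symm.toEquiv.subsingleton
  refine subsingleton_of_forall_eq 0 fun w => ?_
  by_contra hw
  obtain ⟨r, hr, hr'⟩ := exists_socle_multiple hw (lc_torsion _ i w)
  obtain ⟨g, hg, -⟩ := exists_hom_ne_zero D hr hr'
  exact hg (Subsingleton.elim _ _)

include hrs hreg hD in
lemma lc_ring_equiv_hom : Nonempty (lc (maximalIdeal A) rs.length A ≃ₗ[A]
    (D →ₗ[A] lc (maximalIdeal A) rs.length D)) := by
  have := hD.finite
  obtain ⟨e⟩ := lc_hom_equiv (maximalIdeal A) (D := D) (N := D) rs.length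
    (fun j hj => lc_dualizing_subsingleton hrs hreg hD j hj) (fun j hj _ => hD.ext_vanishing j hj)
  exact ⟨(lcCongr (maximalIdeal A) _ (LinearEquiv.ofBijective _ hD.homothety_bijective)).trans e⟩

include hrs hreg hlen hD in
/-- The top local cohomology of a dualizing module is injective. -/
theorem injective_lc_dualizing : Module.Injective A (lc (maximalIdeal A) rs.length D) := by
  obtain ⟨n, hn⟩ := hD.finite_injectiveDimension
  refine injective_of_torsion (maximalIdeal A) (lc_torsion _ _) fun I k g hI _ => ?_
  have htor : ∀ x : A ⧸ I, ∃ k : ℕ, ∀ r ∈ maximalIdeal A ^ k, r • x = 0 := by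
    intro x
    obtain ⟨x, rfl⟩ := Submodule.Quotient.mk_surjective _ x
    exact ⟨k, fun r hr => (Submodule.Quotient.mk_eq_zero _).2 (Ideal.mul_mem_right _ _ (hI hr))⟩
  have hext := extVanishes_one_lc (maximalIdeal A) htor rs.length
    (fun j hj => lc_dualizing_subsingleton hrs hreg hD j hj)
    (extVanishes_of_length_lt hreg hlen hn _ (Nat.lt_succ_self _) (A ⧸ I) htor)
  obtain ⟨ψ, hψ⟩ := exists_extension_of_extVanishes I.injective_subtype
    (LinearMap.exact_subtype_mkQ I) (Submodule.mkQ_surjective _) hext g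
  refine ⟨ψ 1, fun x => ?_⟩
  rw [← map_smul, smul_eq_mul, mul_one, ← hψ]
  rfl

include hrs hreg hlen hD in
/-- The top local cohomology of a dualizing module is nonzero and indecomposable. -/
theorem indecomposable_lc_dualizing : Nontrivial (lc (maximalIdeal A) rs.length D) ∧
    ∀ e : lc (maximalIdeal A) rs.length D →ₗ[A] lc (maximalIdeal A) rs.length D,
      e ∘ₗ e = e → e = 0 ∨ e = LinearMap.id := by
  have := hD.finite
  have := hD.nontrivial
  obtain ⟨Θ⟩ := lc_ring_equiv_hom hrs hreg hD
  obtain ⟨k, hk⟩ := exists_pow_le_ofList hreg hlen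
  obtain ⟨φ, hφ, hφ'⟩ := (lc_of_isWeaklyRegular (maximalIdeal A) rs hrs hreg.toIsWeaklyRegular).2
    fun x => ⟨k, fun r hr => Submodule.smul_mem_smul (hk hr) trivial⟩
  have hmem : ∀ x : A, φ x = 0 ↔ x ∈ Ideal.ofList rs := fun x => by
    rw [← LinearMap.mem_ker, hφ, smul_eq_mul, Ideal.mul_top]
  let ψ : A →ₗ[A] D →ₗ[A] lc (maximalIdeal A) rs.length D := Θ.toLinearMap ∘ₗ φ
  have hψ0 : ∀ x, ψ x = 0 ↔ x ∈ Ideal.ofList rs := fun x => by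
    rw [← hmem]; exact Θ.map_eq_zero_iff
  have hψ' : ∀ g : D →ₗ[A] lc (maximalIdeal A) rs.length D, (∀ r ∈ rs, r • g = 0) →
      ∃ x, ψ x = g := fun g hg => by
    obtain ⟨x, hx⟩ := hφ' (Θ.symm g) fun r hr => by rw [← map_smul, hg r hr, map_zero]
    exact ⟨x, by rw [LinearMap.comp_apply, hx]; exact Θ.apply_symm_apply g⟩
  have hne : ψ 1 ≠ 0 := fun h => hreg.top_ne_smul (by
    rw [smul_eq_mul, Ideal.mul_top, (Ideal.eq_top_iff_one _).2 ((hψ0 1).1 h)])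
  refine ⟨?_, fun e he => ?_⟩
  · by_contra h
    rw [not_nontrivial_iff_subsingleton] at h
    exact hne (LinearMap.ext fun d => Subsingleton.elim _ _)
  · -- An idempotent that annihilates the image of `ψ` vanishes.
    have key : ∀ e : lc (maximalIdeal A) rs.length D →ₗ[A] lc (maximalIdeal A) rs.length D,
        e ∘ₗ e = e → e ∘ₗ ψ 1 = 0 → e = 0 := by
      intro e he h
      by_contra h0
      obtain ⟨w, hw⟩ : ∃ w, e w ≠ 0 := by
        by_contra! hall
        exact h0 (LinearMap.ext hall)
      obtain ⟨r, hr, hr'⟩ := exists_socle_multiple hw (lc_torsion _ _ (e w))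
      obtain ⟨g, hg, hgr, hgm⟩ := exists_hom_ne_zero D hr hr'
      obtain ⟨x, hx⟩ := hψ' g fun s hs => hgm s (hrs s hs)
      refine hg (LinearMap.ext fun d => ?_)
      obtain ⟨s, hs⟩ := hgr d
      have h1 : e (g d) = g d := by
        rw [hs, map_smul, map_smul, ← LinearMap.comp_apply, he]
      have h2 : ψ x = x • ψ 1 := by rw [← map_smul, smul_eq_mul, mul_one]
      rw [← h1, ← hx, h2, LinearMap.smul_apply, map_smul, ← LinearMap.comp_apply, h]
      simp
    obtain ⟨c, hc⟩ := hψ' (e ∘ₗ ψ 1) fun r hr => by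
      rw [← LinearMap.comp_smul, ← map_smul, (hψ0 _).2, LinearMap.comp_zero]
      rw [smul_eq_mul, mul_one]
      exact Ideal.subset_span hr
    have hcψ : e ∘ₗ ψ 1 = c • ψ 1 := by rw [← hc, ← map_smul, smul_eq_mul, mul_one]
    have hidem : c * (1 - c) ∈ Ideal.ofList rs := by
      rw [← hψ0]
      have h1 : c • c • ψ 1 = c • ψ 1 := by
        conv_lhs => rw [← hcψ, ← LinearMap.comp_smul, ← hcψ, ← LinearMap.comp_assoc, he, hcψ]
      rw [mul_sub, mul_one, map_sub, ← mul_one c, ← smul_eq_mul, map_smul, smul_eq_mul, mul_one,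
        ← smul_eq_mul, map_smul, ← mul_one c, ← smul_eq_mul, map_smul, smul_eq_mul, mul_one, h1,
        sub_self]
    rcases IsLocalRing.isUnit_or_isUnit_one_sub_self c with hu | hu
    · right
      have h1 : 1 - c ∈ Ideal.ofList rs := (Ideal.unit_mul_mem_iff_mem _ hu).1 hidem
      have h2 := key (LinearMap.id - e) (by
        simp [LinearMap.sub_comp, LinearMap.comp_sub, he]) (by
        rw [LinearMap.sub_comp, hcψ, LinearMap.id_comp]
        have := (hψ0 _).2 h1
        rwa [← mul_one (1 - c), ← smul_eq_mul, map_smul, sub_smul, one_smul] at this)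
      exact (sub_eq_zero.1 h2).symm
    · left
      refine key e he ?_
      rw [mul_comm] at hidem
      have h1 : c ∈ Ideal.ofList rs := (Ideal.unit_mul_mem_iff_mem _ hu).1 hidem
      rw [hcψ, ← map_smul, smul_eq_mul, mul_one]
      exact (hψ0 _).2 h1

end Dualizing

end LocalDuality

section Localize

variable {R : Type u} [CommRing R] (S : Submonoid R)

/-- An injective module over a flat algebra is injective over the base ring. -/
lemma injective_of_flat_algebra (R : Type u) [CommRing R] {A J : Type u} [CommRing A] [Algebra R A]
    [Module.Flat R A] [AddCommGroup J] [Module R J] [Module A J] [IsScalarTower R A J]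
    [Module.Injective A J] : Module.Injective R J where
  out X Y _ _ _ _ f hf g := by
    obtain ⟨e, he⟩ := Module.Injective.out (R := A) (f.baseChange A)
      (Module.Flat.lTensor_preserves_injective_linearMap f hf) (g.liftBaseChange A)
    refine ⟨e.restrictScalars R ∘ₗ TensorProduct.mk R A Y 1, fun x => ?_⟩
    simpa using he (1 ⊗ₜ x)

lemma extVanishes_one_of_surjective {L N N' N'' : Type u} [AddCommGroup L] [Module R L]
    [AddCommGroup N] [Module R N] [AddCommGroup N'] [Module R N'] [AddCommGroup N''] [Module R N'']
    {f : N →ₗ[R] N'} {g : N' →ₗ[R] N''} (hf : Function.Injective f)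
    (hfg : Function.Exact f g) (hg : Function.Surjective g) [Module.Injective R N']
    (h : ∀ φ : L →ₗ[R] N'', ∃ ψ : L →ₗ[R] N', g ∘ₗ ψ = φ) : ExtVanishes R L N 1 := by
  obtain ⟨w, hS⟩ := exists_shortExact hf hfg hg
  refine subsingleton_of_forall_eq 0 fun x => ?_
  obtain ⟨y, rfl⟩ := Abelian.Ext.covariant_sequence_exact₁ _ hS x
    ((extVanishes_of_injective (N := N') 0).elim _ _) rfl
  obtain ⟨φ, rfl⟩ := (Abelian.Ext.mk₀_bijective _ _).2 y
  obtain ⟨ψ, hψ⟩ := h φ.hom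
  have hφ : φ = ModuleCat.ofHom ψ ≫ ModuleCat.ofHom g := ModuleCat.hom_ext hψ.symm
  rw [hφ, ← Abelian.Ext.mk₀_comp_mk₀, Abelian.Ext.comp_assoc_of_second_deg_zero]
  exact (congrArg (fun z => (Abelian.Ext.mk₀ (ModuleCat.ofHom ψ)).comp z (zero_add 1))
    hS.comp_extClass).trans (Abelian.Ext.comp_zero ..)

/-- Vanishing of `Ext` out of a finitely generated module localizes. -/
theorem extVanishes_localizedModule [IsNoetherianRing R] {L N : Type u} [AddCommGroup L]
    [Module R L] [Module.Finite R L] [AddCommGroup N] [Module R N] (n : ℕ)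
    (h : ExtVanishes R L N (n + 1)) :
    ExtVanishes (Localization S) (LocalizedModule S L) (LocalizedModule S N) (n + 1) := by
  obtain ⟨J, _, _, i, _, hi⟩ := exists_injective_embedding R N
  have hq := Submodule.mkQ_surjective (LinearMap.range i)
  have hiq := LinearMap.exact_map_mkQ_range i
  have hi' : Function.Injective (LocalizedModule.map S i) := LocalizedModule.map_injective S i hi
  have hq' : Function.Surjective (LocalizedModule.map S (LinearMap.range i).mkQ) :=
    LocalizedModule.map_surjective S _ hq
  have hiq' : Function.Exact (LocalizedModule.map S i)
    (LocalizedModule.map S (LinearMap.range i).mkQ) := LocalizedModule.map_exact S _ _ hiq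
  have hJ : Module.Injective (Localization S) (LocalizedModule S J) :=
    Module.injective_of_isLocalizedModule S (LocalizedModule.mkLinearMap S J)
  induction n generalizing N J with
  | zero =>
    refine extVanishes_one_of_surjective hi' hiq' hq' fun φ => ?_
    have : Module.FinitePresentation R L := Module.finitePresentation_of_finite R L
    obtain ⟨⟨f, s⟩, hs⟩ := IsLocalizedModule.surj S
      (LocalizedModule.map S (M := L) (N := J ⧸ LinearMap.range i)) φ
    obtain ⟨ψ, rfl⟩ := exists_lift_of_extVanishes hi hiq hq h f
    refine ⟨Localization.mk 1 s • LocalizedModule.map S ψ, ?_⟩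
    refine LinearMap.ext fun x => ?_
    have h1 : (s : R) • φ x = LocalizedModule.map S (LinearMap.range i).mkQ
        (LocalizedModule.map S ψ x) := (LinearMap.congr_fun hs x).trans
      (LinearMap.congr_fun (IsLocalizedModule.map_comp' S (LocalizedModule.mkLinearMap S L)
        (LocalizedModule.mkLinearMap S J) (LocalizedModule.mkLinearMap S _) ψ _) x)
    rw [LinearMap.comp_apply, LinearMap.smul_apply, map_smul, ← h1,
      ← algebraMap_smul (Localization S) (s : R), ← mul_smul, Localization.mk_eq_mk',
      IsLocalization.mk'_spec, map_one, one_smul]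
  | succ n ih =>
    obtain ⟨J', _, _, i', _, hi''⟩ := exists_injective_embedding R (J ⧸ LinearMap.range i)
    have h1 : ExtVanishes R L (J ⧸ LinearMap.range i) (n + 1) :=
      extVanishes_quotient hi hiq hq h (extVanishes_of_injective n)
    exact extVanishes_sub hi' hiq' hq' (ih h1 J' _ _ i' inferInstance hi''
      (Submodule.mkQ_surjective _)
      (LinearMap.exact_map_mkQ_range i') (LocalizedModule.map_injective S i' hi'')
      (LocalizedModule.map_surjective S _ (Submodule.mkQ_surjective _))
      (LocalizedModule.map_exact S _ _ (LinearMap.exact_map_mkQ_range i'))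
      (Module.injective_of_isLocalizedModule S (LocalizedModule.mkLinearMap S J')))
      (extVanishes_of_injective _)

/-- Dualizing modules localize. -/
theorem IsDualizing.localizedModule [IsNoetherianRing R] {D : Type u} [AddCommGroup D] [Module R D]
    (hD : IsDualizing R D) : IsDualizing (Localization S) (LocalizedModule S D) := by
  have := hD.finite
  refine ⟨⟨Module.Finite.of_isLocalizedModule S (LocalizedModule.mkLinearMap S D), ?_,
    fun i hi => ?_⟩, ?_⟩
  · have : Module.FinitePresentation R D := Module.finitePresentation_of_finite R D
    have h : IsLocalizedModule.map S (Algebra.linearMap R (Localization S))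
        (LocalizedModule.map S (M := D) (N := D)) (LinearMap.lsmul R D) =
        (LinearMap.lsmul (Localization S) (LocalizedModule S D)).restrictScalars R := by
      refine IsLocalizedModule.linearMap_ext S (Algebra.linearMap R (Localization S))
        (LocalizedModule.map S (M := D) (N := D)) ?_
      rw [IsLocalizedModule.map_comp]
      refine LinearMap.ext fun r => LinearMap.restrictScalars_injective R ?_
      refine IsLocalizedModule.linearMap_ext S (LocalizedModule.mkLinearMap S D)
        (LocalizedModule.mkLinearMap S D) (LinearMap.ext fun d => ?_)
      change IsLocalizedModule.map S (LocalizedModule.mkLinearMap S D)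
        (LocalizedModule.mkLinearMap S D) (LinearMap.lsmul R D r)
        (LocalizedModule.mkLinearMap S D d) =
          algebraMap R (Localization S) r • LocalizedModule.mkLinearMap S D d
      rw [IsLocalizedModule.map_apply, algebraMap_smul, ← map_smul]
      rfl
    have h1 := IsLocalizedModule.map_injective S (Algebra.linearMap R (Localization S))
      (LocalizedModule.map S (M := D) (N := D)) _ hD.homothety_bijective.1
    have h2 := IsLocalizedModule.map_surjective S (Algebra.linearMap R (Localization S))
      (LocalizedModule.map S (M := D) (N := D)) _ hD.homothety_bijective.2
    rw [h] at h1 h2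
    exact ⟨h1, h2⟩
  · obtain ⟨i, rfl⟩ := Nat.exists_eq_add_of_le' hi
    exact extVanishes_localizedModule S i (hD.ext_vanishing (i + 1) hi)
  · obtain ⟨n, hn⟩ := hD.finite_injectiveDimension
    refine ⟨n, ?_⟩
    have := (ModuleCat.of R D).localizedModule_hasInjectiveDimensionLE n S
    let e : (ModuleCat.of R D).localizedModule S ≅ ModuleCat.of _ (LocalizedModule S D) :=
      (Shrink.linearEquiv (Localization S) (LocalizedModule S D)).toModuleIso
    exact hasInjectiveDimensionLT_of_iso e _

end Localize

section DerivedComparison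

universe v₁ v₂ v₃ v₄ u₁ u₂ u₃ u₄

variable {C : Type u₁} [Category.{v₁} C] [Abelian C] [EnoughInjectives C]
  {C' : Type u₂} [Category.{v₂} C'] [Abelian C'] [EnoughInjectives C']
  {D : Type u₃} [Category.{v₃} D] [Abelian D] {D' : Type u₄} [Category.{v₄} D'] [Abelian D']

/-- Right derived functors commute with exact functors that preserve injective objects. -/
theorem nonempty_rightDerived_iso (F : C ⥤ D) [F.Additive] (F' : C' ⥤ D') [F'.Additive]
    (Φ : C' ⥤ C) [Φ.Additive] [Φ.PreservesInjectiveObjects] [Φ.PreservesHomology]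
    (Ψ : D' ⥤ D) [Ψ.Additive] [Ψ.PreservesHomology] (e : F' ⋙ Ψ ≅ Φ ⋙ F) (n : ℕ) (Z : C') :
    Nonempty ((F.rightDerived n).obj (Φ.obj Z) ≅ Ψ.obj ((F'.rightDerived n).obj Z)) := by
  let I := InjectiveResolution.of Z
  let J := mapInjectiveResolution Φ I
  let K := (F'.mapHomologicalComplex (ComplexShape.up ℕ)).obj I.cocomplex
  have e₁ : (Ψ.mapHomologicalComplex _).obj K ≅
      (F.mapHomologicalComplex _).obj ((Φ.mapHomologicalComplex _).obj I.cocomplex) :=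
    HomologicalComplex.Hom.isoOfComponents (fun i => e.app (I.cocomplex.X i))
      (fun i j _ => (e.hom.naturality (I.cocomplex.d i j)).symm)
  have e₂ : (F.rightDerived n).obj (Φ.obj Z) ≅ _ := J.isoRightDerivedObj F n
  have e₃ : (F'.rightDerived n).obj Z ≅ K.homology n := I.isoRightDerivedObj F' n
  have e₄ : ((Ψ.mapHomologicalComplex _).obj K).homology n ≅ Ψ.obj (K.homology n) :=
    (K.sc n).mapHomologyIso Ψ
  exact ⟨e₂ ≪≫ ((HomologicalComplex.homologyFunctor D (ComplexShape.up ℕ) n).mapIso e₁).symm ≪≫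
    e₄ ≪≫ Ψ.mapIso e₃.symm⟩

end DerivedComparison

section RestrictScalars

variable {R A : Type u} [CommRing R] [CommRing A] [Algebra R A]

instance [Module.Flat R A] :
    (ModuleCat.restrictScalars.{u} (algebraMap R A)).PreservesInjectiveObjects where
  injective_obj {J} hJ := by
    have h1 : Module.Injective A J := Module.injective_module_of_injective_object A J
    let X := (ModuleCat.restrictScalars.{u} (algebraMap R A)).obj J
    let : Module A X := inferInstanceAs (Module A J)
    have : IsScalarTower R A X := ⟨fun r a x => by
      rw [Algebra.smul_def, mul_smul]; rfl⟩
    have : Module.Injective A X := h1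
    have h2 : Module.Injective R X := injective_of_flat_algebra R (A := A)
    exact Module.injective_object_of_injective_module R X

lemma mem_torsionSubmodule_map_iff (a : Ideal R) {N : Type u} [AddCommGroup N] [Module R N]
    [Module A N] [IsScalarTower R A N] (x : N) :
    x ∈ torsionSubmodule (a.map (algebraMap R A)) N ↔ x ∈ torsionSubmodule a N := by
  refine exists_congr fun m => ?_
  rw [← Ideal.map_pow]
  refine ⟨fun h r hr => ?_, fun h r hr => ?_⟩
  · rw [← algebraMap_smul A]
    exact h _ (Ideal.mem_map_of_mem _ hr)
  · refine Submodule.span_induction (p := fun r _ => r • x = 0) ?_ (zero_smul _ _) ?_ ?_ hr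
    · rintro _ ⟨r, hr, rfl⟩
      rw [algebraMap_smul, h r hr]
    · intro r s _ _ hr hs
      rw [add_smul, hr, hs, add_zero]
    · intro r s _ hs
      rw [smul_eq_mul, mul_smul, hs, smul_zero]

/-- The torsion functor commutes with restriction of scalars. -/
noncomputable def torsionFunctorRestrictScalars (a : Ideal R) :
    torsionFunctor (a.map (algebraMap R A)) ⋙ ModuleCat.restrictScalars.{u} (algebraMap R A) ≅
      ModuleCat.restrictScalars.{u} (algebraMap R A) ⋙ torsionFunctor a :=
  NatIso.ofComponents (fun N => by
    let : Module R N := Module.compHom N (algebraMap R A)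
    have : IsScalarTower R A N := ⟨fun r a x => by
      rw [Algebra.smul_def, mul_smul]; rfl⟩
    let e : (ModuleCat.restrictScalars.{u} (algebraMap R A)).obj
        ((torsionFunctor (a.map (algebraMap R A))).obj N) ≃ₗ[R]
        (torsionFunctor a).obj ((ModuleCat.restrictScalars.{u} (algebraMap R A)).obj N) :=
      { toFun := fun x => ⟨x.1, (mem_torsionSubmodule_map_iff (A := A) a (N := N) x.1).1 x.2⟩
        invFun := fun x => ⟨x.1, (mem_torsionSubmodule_map_iff (A := A) a (N := N) x.1).2 x.2⟩
        map_add' := fun _ _ => rfl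
        map_smul' := fun _ _ => rfl
        left_inv := fun _ => rfl
        right_inv := fun _ => rfl }
    exact e.toModuleIso) (fun _ => rfl)

theorem nonempty_rightDerived_restrictScalars_iso [Module.Flat R A] (a : Ideal R) (n : ℕ)
    (N : ModuleCat.{u} A) :
    Nonempty (((torsionFunctor a).rightDerived n).obj
      ((ModuleCat.restrictScalars.{u} (algebraMap R A)).obj N) ≅
      (ModuleCat.restrictScalars.{u} (algebraMap R A)).obj
        (((torsionFunctor (a.map (algebraMap R A))).rightDerived n).obj N)) :=
  nonempty_rightDerived_iso (torsionFunctor a) (torsionFunctor (a.map (algebraMap R A))) _ _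
    (torsionFunctorRestrictScalars a) n N

/-- Local cohomology does not depend on the base ring. -/
theorem exists_lc_addEquiv [Module.Flat R A] (a : Ideal R) (n : ℕ) (N : Type u) [AddCommGroup N]
    [Module R N] [Module A N] [IsScalarTower R A N] :
    ∃ e : lc a n N ≃+ lc (a.map (algebraMap R A)) n N, ∀ (r : R) x,
      e (r • x) = algebraMap R A r • e x := by
  obtain ⟨e⟩ := nonempty_rightDerived_restrictScalars_iso a n (ModuleCat.of A N)
  let i : ModuleCat.of R N ≅ (ModuleCat.restrictScalars.{u} (algebraMap R A)).obj
      (ModuleCat.of A N) :=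
    LinearEquiv.toModuleIso (show N ≃ₗ[R] (ModuleCat.restrictScalars.{u} (algebraMap R A)).obj
      (ModuleCat.of A N) from { AddEquiv.refl N with
        map_smul' := fun r x => (algebraMap_smul A r x).symm })
  let e' := (((torsionFunctor a).rightDerived n).mapIso i ≪≫ e).toLinearEquiv
  exact ⟨e'.toAddEquiv, fun r x => e'.map_smul r x⟩

/-- Local cohomology commutes with restriction of scalars, in all integral degrees. -/
theorem nonempty_localCohomologyModule_restrictScalars_iso [Module.Flat R A] (a : Ideal R) (i : ℤ)
    (N : Type u) [AddCommGroup N] [Module R N] [Module A N] [IsScalarTower R A N] :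
    Nonempty (localCohomologyModule a i (ModuleCat.of R N) ≅
      (ModuleCat.restrictScalars (algebraMap R A)).obj
        (localCohomologyModule (a.map (algebraMap R A)) i (ModuleCat.of A N))) := by
  cases i with
  | ofNat n =>
    obtain ⟨e, he⟩ := exists_lc_addEquiv (A := A) a n N
    exact ⟨LinearEquiv.toModuleIso (show lc a n N ≃ₗ[R]
      (ModuleCat.restrictScalars (algebraMap R A)).obj
        (((torsionFunctor (a.map (algebraMap R A))).rightDerived n).obj (ModuleCat.of A N)) from
      { e with map_smul' := he })⟩
  | negSucc n =>
    exact ⟨LinearEquiv.toModuleIso (show PUnit.{u + 1} ≃ₗ[R]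
      (ModuleCat.restrictScalars (algebraMap R A)).obj (ModuleCat.of A PUnit.{u + 1}) from
      { AddEquiv.refl PUnit.{u + 1} with map_smul' := fun _ _ => rfl })⟩

end RestrictScalars

section InjectiveHull

variable {R : Type u} [CommRing R] {p : Ideal R} [p.IsPrime]

/-- A nonzero indecomposable torsion injective module over `R_p` is an injective hull of `R/p`. -/
theorem IsInjectiveHull.nonempty_equiv {E W : Type u} [AddCommGroup E] [Module R E]
    {ι : (R ⧸ p) →ₗ[R] E} (hE : IsInjectiveHull R ι) [AddCommGroup W] [Module R W]
    [Module (Localization.AtPrime p) W] [IsScalarTower R (Localization.AtPrime p) W]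
    [Module.Injective (Localization.AtPrime p) W] [Nontrivial W]
    (htor : ∀ w : W, ∃ m : ℕ,
      ∀ r ∈ IsLocalRing.maximalIdeal (Localization.AtPrime p) ^ m, r • w = 0)
    (hind : ∀ e : W →ₗ[Localization.AtPrime p] W, e ∘ₗ e = e → e = 0 ∨ e = LinearMap.id) :
    Nonempty (E ≃ₗ[R] W) := by
  have := hE.module_injective
  have : Module.Flat R (Localization.AtPrime p) := IsLocalization.flat _ p.primeCompl
  have : Module.Injective R W := injective_of_flat_algebra R (A := Localization.AtPrime p)
  obtain ⟨w₀, hw₀⟩ := exists_ne (0 : W)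
  obtain ⟨c, hw, hm⟩ := exists_socle_multiple hw₀ (htor w₀)
  set w := c • w₀
  have hker : ∀ r : R, r • w = 0 ↔ r ∈ p := by
    intro r
    rw [← algebraMap_smul (Localization.AtPrime p)]
    constructor
    · intro h
      by_contra hr
      exact hw ((IsLocalization.map_units (Localization.AtPrime p)
        (⟨r, hr⟩ : p.primeCompl)).smul_eq_zero.1 h)
    · intro hr
      refine hm _ ?_
      rw [← Localization.AtPrime.map_eq_maximalIdeal]
      exact Ideal.mem_map_of_mem _ hr
  let j : (R ⧸ p) →ₗ[R] W := p.liftQ (LinearMap.toSpanSingleton R W w) fun r hr => (hker r).2 hr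
  have hj : Function.Injective j := LinearMap.ker_eq_bot.1
    (Submodule.ker_liftQ_eq_bot _ _ _ fun r hr => (hker r).1 hr)
  obtain ⟨f, hf⟩ := Module.Injective.out (R := R) ι hE.injective j
  have hfinj : Function.Injective f := by
    rw [← LinearMap.ker_eq_bot]
    refine hE.essential _ ?_
    rw [eq_bot_iff]
    rintro _ ⟨hx, y, rfl⟩
    have : j y = 0 := (hf y).symm.trans hx
    rw [hj (this.trans (map_zero j).symm), map_zero]
    exact Submodule.zero_mem _
  obtain ⟨ρ, hρ⟩ := Module.Injective.out (R := R) f hfinj LinearMap.id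
  let e : W →ₗ[Localization.AtPrime p] W :=
    LinearMap.extendScalarsOfIsLocalization p.primeCompl (Localization.AtPrime p) (f ∘ₗ ρ)
  have he : ∀ x, e x = f (ρ x) := fun _ => rfl
  refine ⟨LinearEquiv.ofBijective f ⟨hfinj, fun x => ?_⟩⟩
  rcases hind e (LinearMap.ext fun x => by
    rw [LinearMap.comp_apply, he, he, hρ]; rfl) with h | h
  · exfalso
    refine hw ?_
    have h1 : f (ι (Submodule.Quotient.mk 1)) = w := (hf _).trans (one_smul R w)
    have h2 : e w = w := by rw [← h1, he, hρ]; rfl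
    rw [← h2, h, LinearMap.zero_apply]
  · exact ⟨ρ x, by rw [← he, h]; rfl⟩

end InjectiveHull

section AtPrime

/-- The localization of the regular module is the localized ring. -/
noncomputable def localizedModuleSelfEquiv {R : Type u} [CommRing R] (S : Submonoid R) :
    LocalizedModule S R ≃ₗ[Localization S] Localization S :=
  LinearEquiv.extendScalarsOfIsLocalization S (Localization S)
    (IsLocalizedModule.linearEquiv S (LocalizedModule.mkLinearMap S R)
      (Algebra.linearMap R (Localization S)))

variable {R : Type u} [CommRing R] (hR : IsCohenMacaulay R) (p : Ideal R) [p.IsPrime] {h : ℕ}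
  (hh : p.height = h)

include hR hh

lemma exists_regular_sequence : ∃ rs : List (Localization.AtPrime p),
    (∀ r ∈ rs, r ∈ IsLocalRing.maximalIdeal (Localization.AtPrime p)) ∧
      RingTheory.Sequence.IsRegular (Localization.AtPrime p) rs ∧
      (rs.length : WithBot ℕ∞) = ringKrullDim (Localization.AtPrime p) ∧ rs.length = h := by
  obtain ⟨rs, h₁, h₂, h₃⟩ := hR.local_cohenMacaulay p
  refine ⟨rs, h₁, h₂, h₃, ?_⟩
  rw [IsLocalization.AtPrime.ringKrullDim_eq_height p, hh] at h₃
  exact_mod_cast h₃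

/-- Local cohomology of a localized module at `p` vanishes above the height of `p`. -/
theorem lc_subsingleton_of_height_lt (i : ℕ) (hi : h < i) (N : Type u) [AddCommGroup N]
    [Module R N] [Module (Localization.AtPrime p) N] [IsScalarTower R (Localization.AtPrime p) N] :
    Subsingleton (lc p i N) := by
  have := hR.noetherian
  have : IsNoetherianRing (Localization.AtPrime p) :=
    IsLocalization.isNoetherianRing p.primeCompl _ inferInstance
  have : Module.Flat R (Localization.AtPrime p) := IsLocalization.flat _ p.primeCompl
  obtain ⟨rs, h₁, h₂, h₃, rfl⟩ := exists_regular_sequence hR p hh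
  obtain ⟨e, -⟩ := exists_lc_addEquiv (A := Localization.AtPrime p) p i N
  rw [Localization.AtPrime.map_eq_maximalIdeal] at e
  obtain ⟨e'⟩ := lc_equiv_of_pow_le (exists_pow_le_ofList h₂ h₃)
    (Ideal.span_le.2 fun r hr => h₁ r hr) i N
  have := lc_subsingleton_of_length_lt rs i hi N
  exact (e.toEquiv.trans e'.toEquiv).subsingleton

/-- Local cohomology of `R_p` at `p` vanishes below the height of `p`. -/
theorem lc_subsingleton_of_lt_height (i : ℕ) (hi : i < h) :
    Subsingleton (lc p i (LocalizedModule p.primeCompl R)) := by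
  have : Module.Flat R (Localization.AtPrime p) := IsLocalization.flat _ p.primeCompl
  obtain ⟨rs, h₁, h₂, h₃, rfl⟩ := exists_regular_sequence hR p hh
  obtain ⟨e, -⟩ := exists_lc_addEquiv (A := Localization.AtPrime p) p i
    (LocalizedModule p.primeCompl R)
  rw [Localization.AtPrime.map_eq_maximalIdeal] at e
  have := (lc_of_isWeaklyRegular (IsLocalRing.maximalIdeal (Localization.AtPrime p)) rs h₁
    h₂.toIsWeaklyRegular).1 i hi
  exact (e.toEquiv.trans (lcCongr _ i (localizedModuleSelfEquiv p.primeCompl)).toEquiv).subsingleton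

/-- The top local cohomology of `R_p` is `Hom(D, E(R/p))`. -/
theorem nonempty_lc_equiv_hom {D : Type u} [AddCommGroup D] [Module R D] (hD : IsDualizing R D)
    {E : Type u} [AddCommGroup E] [Module R E] {ι : (R ⧸ p) →ₗ[R] E} (hE : IsInjectiveHull R ι) :
    Nonempty (lc p h (LocalizedModule p.primeCompl R) ≃ₗ[R] (D →ₗ[R] E)) := by
  have := hR.noetherian
  let A := Localization.AtPrime p
  have : IsNoetherianRing A := IsLocalization.isNoetherianRing p.primeCompl _ inferInstance
  have : Module.Flat R A := IsLocalization.flat _ p.primeCompl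
  obtain ⟨rs, h₁, h₂, h₃, rfl⟩ := exists_regular_sequence hR p hh
  have hDp : IsDualizing A (LocalizedModule p.primeCompl D) := hD.localizedModule p.primeCompl
  let W := lc (IsLocalRing.maximalIdeal A) rs.length (LocalizedModule p.primeCompl D)
  have hinj : Module.Injective A W := injective_lc_dualizing h₁ h₂ h₃ hDp
  obtain ⟨hnt, hind⟩ := indecomposable_lc_dualizing h₁ h₂ h₃ hDp
  let : Module R W := Module.compHom W (algebraMap R A)
  have : IsScalarTower R A W := ⟨fun r a x => by rw [Algebra.smul_def, mul_smul]; rfl⟩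
  obtain ⟨eE⟩ := hE.nonempty_equiv (W := W) (lc_torsion _ _) hind
  obtain ⟨e₁, he₁⟩ : ∃ e : lc p rs.length (LocalizedModule p.primeCompl R) ≃+
      lc (IsLocalRing.maximalIdeal A) rs.length (LocalizedModule p.primeCompl R),
      ∀ (r : R) x, e (r • x) = algebraMap R A r • e x := by
    rw [← Localization.AtPrime.map_eq_maximalIdeal]
    exact exists_lc_addEquiv p rs.length (LocalizedModule p.primeCompl R)
  obtain ⟨e₃⟩ := lc_ring_equiv_hom h₁ h₂ hDp
  let e₂ : LocalizedModule p.primeCompl R ≃ₗ[A] A := localizedModuleSelfEquiv p.primeCompl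
  let e₄ : (D →ₗ[R] W) ≃ₗ[A] (LocalizedModule p.primeCompl D →ₗ[A] W) :=
    (LinearMap.liftBaseChangeEquiv A).trans
      ((LocalizedModule.equivTensorProduct p.primeCompl D).symm.arrowCongr (LinearEquiv.refl A W))
  let g := (lcCongr (IsLocalRing.maximalIdeal A) rs.length e₂).trans (e₃.trans e₄.symm)
  let e₅ : (D →ₗ[R] W) ≃ₗ[R] (D →ₗ[R] E) := (LinearEquiv.refl R D).arrowCongr eE.symm
  refine ⟨{ (e₁.trans g.toAddEquiv).trans e₅.toAddEquiv with map_smul' := fun r x => ?_ }⟩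
  change e₅ (g (e₁ (r • x))) = r • e₅ (g (e₁ x))
  rw [he₁, map_smul, ← map_smul e₅]
  congr 1

end AtPrime

section NaturalTransformation

universe v₁ v₂ u₁ u₂
variable {C : Type u₁} [Category.{v₁} C] [Abelian C]
  {D : Type u₂} [Category.{v₂} D] [Abelian D]

lemma augmentation_mapInjectiveResolution (Φ : C ⥤ D) [Φ.Additive] [Φ.PreservesInjectiveObjects]
    [Φ.PreservesHomology] {Z : C} (I : InjectiveResolution Z) :
    augmentation (mapInjectiveResolution Φ I) = Φ.map (augmentation I) := by
  have h : (mapInjectiveResolution Φ I).ι.f 0 =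
    ((HomologicalComplex.singleMapHomologicalComplex Φ (ComplexShape.up ℕ) 0).inv.app Z).f 0 ≫
      Φ.map (I.ι.f 0) := rfl
  refine h.trans ?_
  rw [HomologicalComplex.singleMapHomologicalComplex_inv_app_self]
  change (𝟙 _ ≫ Φ.map (𝟙 Z)) ≫ Φ.map (augmentation I) = _
  simp

lemma mapInjectiveResolution_natTrans {Φ Φ' : C ⥤ D} [Φ.Additive] [Φ.PreservesInjectiveObjects]
    [Φ.PreservesHomology] [Φ'.Additive] [Φ'.PreservesInjectiveObjects]
    [Φ'.PreservesHomology] (η : Φ ⟶ Φ') {Z : C} (I : InjectiveResolution Z) :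
    augmentation (mapInjectiveResolution Φ I) ≫ η.app (I.cocomplex.X 0) =
      η.app Z ≫ augmentation (mapInjectiveResolution Φ' I) := by
  rw [augmentation_mapInjectiveResolution, augmentation_mapInjectiveResolution]
  exact η.naturality _

end NaturalTransformation

section SumLocalization

variable {R : Type u} [CommRing R] (S : Submonoid R)

/-- The map of localized modules induced by a linear map, as a map over the base ring. -/
noncomputable def locMap {M N : Type u} [AddCommGroup M] [Module R M] [AddCommGroup N]
    [Module R N] :
    (M →ₗ[R] N) →ₗ[R] (LocalizedModule S M →ₗ[R] LocalizedModule S N) :=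
  IsLocalizedModule.map S (LocalizedModule.mkLinearMap S M) (LocalizedModule.mkLinearMap S N)

lemma locMap_id {M : Type u} [AddCommGroup M] [Module R M] :
    locMap S (LinearMap.id : M →ₗ[R] M) = LinearMap.id := IsLocalizedModule.map_id S _

lemma locMap_comp {M N P : Type u} [AddCommGroup M] [Module R M] [AddCommGroup N] [Module R N]
    [AddCommGroup P] [Module R P] (g : N →ₗ[R] P) (f : M →ₗ[R] N) :
    locMap S (g ∘ₗ f) = locMap S g ∘ₗ locMap S f :=
  IsLocalizedModule.map_comp' S _ _ _ f g

/-- Localization as an endofunctor of the category of modules. -/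
noncomputable def locFunctor : ModuleCat.{u} R ⥤ ModuleCat.{u} R where
  obj M := ModuleCat.of R (LocalizedModule S M)
  map f := ModuleCat.ofHom (locMap S f.hom)
  map_id M := by rw [ModuleCat.hom_id, locMap_id]; rfl
  map_comp f g := by rw [ModuleCat.hom_comp, locMap_comp]; rfl

instance : (locFunctor S).Additive where
  map_add {_ _ f g} := by
    change ModuleCat.ofHom (locMap S (f.hom + g.hom)) =
      ModuleCat.ofHom (locMap S f.hom) + ModuleCat.ofHom (locMap S g.hom)
    rw [map_add]; rfl

lemma preservesHomology_of_map_exact {R' : Type u} [CommRing R']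
    (Φ : ModuleCat.{u} R ⥤ ModuleCat.{u} R') [Φ.Additive]
    (h : ∀ (T : ShortComplex (ModuleCat.{u} R)), T.Exact → (T.map Φ).Exact) :
    Φ.PreservesHomology := by
  have := ((Functor.exact_tfae Φ).out 1 2).mp h
  exact this

instance : (locFunctor S).PreservesHomology :=
  preservesHomology_of_map_exact _ fun T hT => by
    rw [ShortComplex.ShortExact.moduleCat_exact_iff_function_exact] at hT ⊢
    exact LocalizedModule.map_exact S T.f.hom T.g.hom hT

instance [IsNoetherianRing R] : (locFunctor S).PreservesInjectiveObjects where
  injective_obj {J} hJ := by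
    have : Module.Injective R J := Module.injective_module_of_injective_object R J
    have : Module.Injective (Localization S) (LocalizedModule S J) :=
      Module.injective_of_isLocalizedModule S (LocalizedModule.mkLinearMap S J)
    have : Module.Flat R (Localization S) := IsLocalization.flat _ S
    have : Module.Injective R (LocalizedModule S J) :=
      injective_of_flat_algebra R (A := Localization S)
    exact Module.injective_object_of_injective_module R (LocalizedModule S J)

variable (R) in
/-- The functor `M ↦ M^{(T)}`. -/
noncomputable def sumFunctor (T : Type u) : ModuleCat.{u} R ⥤ ModuleCat.{u} R where
  obj M := ModuleCat.of R (T →₀ M)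
  map f := ModuleCat.ofHom (Finsupp.mapRange.linearMap f.hom)

instance (T : Type u) : (sumFunctor R T).Additive where
  map_add {_ _ f g} := by
    refine ModuleCat.hom_ext (LinearMap.ext fun x => Finsupp.ext fun t => ?_)
    rfl

lemma finsupp_mapRange_exact (T : Type u) {M N P : Type u} [AddCommGroup M] [Module R M]
    [AddCommGroup N] [Module R N] [AddCommGroup P] [Module R P] {f : M →ₗ[R] N} {g : N →ₗ[R] P}
    (h : Function.Exact f g) : Function.Exact (Finsupp.mapRange.linearMap (α := T) f)
      (Finsupp.mapRange.linearMap (α := T) g) := by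
  intro x
  constructor
  · intro hx
    have h : ∀ t, ∃ y, f y = x t := fun t => (h _).1 (DFunLike.congr_fun hx t)
    choose y hy using h
    classical
    refine ⟨Finsupp.onFinset x.support (fun t => if x t = 0 then 0 else y t) fun t ht => ?_,
      Finsupp.ext fun t => ?_⟩
    · rw [Finsupp.mem_support_iff]
      intro h0
      exact ht (if_pos h0)
    · change f (if x t = 0 then 0 else y t) = x t
      split_ifs with h0
      · rw [h0, map_zero]
      · exact hy t
  · rintro ⟨y, rfl⟩
    exact Finsupp.ext fun t => (h _).2 ⟨y t, rfl⟩

instance (T : Type u) : (sumFunctor R T).PreservesHomology :=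
  preservesHomology_of_map_exact _ fun Z hZ => by
    rw [ShortComplex.ShortExact.moduleCat_exact_iff_function_exact] at hZ ⊢
    exact finsupp_mapRange_exact T hZ

/-- Direct sums of copies of an injective module over a noetherian ring are injective. -/
lemma injective_finsupp [IsNoetherianRing R] (T : Type u) {J : Type u} [AddCommGroup J]
    [Module R J] [Module.Injective R J] : Module.Injective R (T →₀ J) := by
  refine Module.Baer.injective fun I g => ?_
  obtain ⟨s, hs⟩ : I.FG := IsNoetherian.noetherian I
  classical
  have hfg : (⊤ : Submodule R I).FG := Module.Finite.fg_top
  obtain ⟨s, hs⟩ := hfg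
  let E : Finset T := s.biUnion fun x => (g x).support
  have hE : ∀ x t, t ∉ E → g x t = 0 := by
    intro x t ht
    have hx : x ∈ Submodule.span R (s : Set I) := hs ▸ trivial
    induction hx using Submodule.span_induction with
    | mem x hx =>
      by_contra h
      exact ht (Finset.mem_biUnion.2 ⟨x, hx, Finsupp.mem_support_iff.2 h⟩)
    | zero => simp
    | add x y _ _ hx hy => rw [map_add, Finsupp.add_apply, hx, hy, add_zero]
    | smul r x _ hx => rw [map_smul, Finsupp.smul_apply, hx, smul_zero]
  have hext : ∀ t, ∃ e : R →ₗ[R] J, ∀ x : I, e x = g x t := fun t =>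
    Module.Injective.out (R := R) I.subtype I.injective_subtype (Finsupp.lapply t ∘ₗ g)
  choose e he using hext
  refine ⟨∑ t ∈ E, Finsupp.lsingle t ∘ₗ e t, fun x hx => Finsupp.ext fun t => ?_⟩
  rw [LinearMap.sum_apply, Finsupp.finsetSum_apply]
  simp only [LinearMap.comp_apply, Finsupp.lsingle_apply, Finsupp.single_apply,
    Finset.sum_ite_eq']
  split_ifs with h
  · exact he t ⟨x, hx⟩
  · exact (hE ⟨x, hx⟩ t h).symm

instance [IsNoetherianRing R] (T : Type u) : (sumFunctor R T).PreservesInjectiveObjects where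
  injective_obj {J} hJ := by
    have : Module.Injective R J := Module.injective_module_of_injective_object R J
    have := injective_finsupp (R := R) T (J := J)
    exact Module.injective_object_of_injective_module R (T →₀ J)

/-- The projection of `M^{(T)}` onto the coordinates in a finite set. -/
noncomputable def finsuppProj {T : Type u} (E : Finset T) (M : Type u) [AddCommGroup M]
    [Module R M] : (T →₀ M) →ₗ[R] (T →₀ M) :=
  ∑ t ∈ E, Finsupp.lsingle t ∘ₗ Finsupp.lapply t

lemma finsuppProj_apply {T : Type u} (E : Finset T) {M : Type u} [AddCommGroup M] [Module R M]
    [DecidableEq T] (x : T →₀ M) (t : T) :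
    finsuppProj (R := R) E M x t = if t ∈ E then x t else 0 := by
  rw [finsuppProj, LinearMap.sum_apply, Finsupp.finsetSum_apply]
  simp only [LinearMap.comp_apply, Finsupp.lsingle_apply, Finsupp.lapply_apply,
    Finsupp.single_apply, Finset.sum_ite_eq']

lemma finsuppProj_self {T : Type u} {M : Type u} [AddCommGroup M] [Module R M] (x : T →₀ M) :
    finsuppProj (R := R) x.support M x = x := by
  classical
  refine Finsupp.ext fun t => ?_
  rw [finsuppProj_apply]
  split_ifs with h
  · rfl
  · exact (Finsupp.notMem_support_iff.1 h).symm

lemma finsuppProj_mapRange {T : Type u} (E : Finset T) {M N : Type u} [AddCommGroup M] [Module R M]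
    [AddCommGroup N] [Module R N] (f : M →ₗ[R] N) : finsuppProj E N ∘ₗ
      Finsupp.mapRange.linearMap f = Finsupp.mapRange.linearMap f ∘ₗ finsuppProj E M := by
  classical
  refine LinearMap.ext fun x => Finsupp.ext fun t => ?_
  rw [LinearMap.comp_apply, LinearMap.comp_apply, finsuppProj_apply,
    Finsupp.mapRange.linearMap_apply, Finsupp.mapRange_apply, Finsupp.mapRange.linearMap_apply,
    Finsupp.mapRange_apply, finsuppProj_apply]
  split_ifs
  · rfl
  · rw [map_zero]

/-- `finsuppProj` as a natural transformation. -/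
noncomputable def sumFunctorProj {T : Type u} (E : Finset T) : sumFunctor R T ⟶ sumFunctor R T where
  app M := ModuleCat.ofHom (finsuppProj E M)
  naturality _ _ f := ModuleCat.hom_ext (finsuppProj_mapRange E f.hom)

end SumLocalization

section FiniteSupport

variable {R : Type u} [CommRing R] (S : Submonoid R) (a : Ideal R)

/-- Local cohomology classes of a localized direct sum have finite support. -/
theorem exists_finsuppProj_fixed [IsNoetherianRing R] (n : ℕ) (T M : Type u) [AddCommGroup M]
    [Module R M] (x : lc a n (LocalizedModule S (T →₀ M))) :
    ∃ E : Finset T, lcMap a n (locMap S (finsuppProj E M)) x = x := by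
  let Φ : ModuleCat.{u} R ⥤ ModuleCat.{u} R := sumFunctor R T ⋙ locFunctor S
  have : Φ.PreservesHomology := preservesHomology_of_map_exact _ fun T hT =>
    (hT.map (sumFunctor R _)).map (locFunctor S)
  let I := InjectiveResolution.of (ModuleCat.of R M)
  let J : InjectiveResolution (Φ.obj (ModuleCat.of R M)) := mapInjectiveResolution Φ I
  let G := (torsionFunctor a).mapHomologicalComplex (ComplexShape.up ℕ)
  let K := G.obj J.cocomplex
  obtain ⟨z, hz⟩ := (ModuleCat.epi_iff_surjective (K.homologyπ n)).1 inferInstance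
    ((J.isoRightDerivedObj (torsionFunctor a) n).hom.hom x)
  let y : torsionSubmodule a (LocalizedModule S (T →₀ I.cocomplex.X n)) := (K.iCycles n).hom z
  obtain ⟨⟨w, s⟩, hw⟩ := IsLocalizedModule.mk'_surjective S
    (LocalizedModule.mkLinearMap S (T →₀ I.cocomplex.X n)) y.1
  refine ⟨w.support, ?_⟩
  let η : Φ ⟶ Φ := Functor.whiskerRight (sumFunctorProj w.support) (locFunctor S)
  let φ : J.cocomplex ⟶ J.cocomplex := (NatTrans.mapHomologicalComplex η _).app I.cocomplex
  have hφ : augmentation J ≫ φ.f 0 = η.app (ModuleCat.of R M) ≫ augmentation J :=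
    mapInjectiveResolution_natTrans η I
  have key := InjectiveResolution.isoRightDerivedObj_hom_naturality (η.app (ModuleCat.of R M)) J J φ
    hφ (torsionFunctor a) n
  have hy : locMap S (finsuppProj w.support _) y.1 = y.1 := by
    rw [← hw]
    exact (IsLocalizedModule.map_mk' S _ _ _ _ _).trans (by rw [finsuppProj_self]; rfl)
  have hz' : (HomologicalComplex.cyclesMap (G.map φ) n).hom z = z := by
    refine (ModuleCat.mono_iff_injective (K.iCycles n)).1 inferInstance ?_
    have h1 := congrArg (fun f => f.hom z) (HomologicalComplex.cyclesMap_i (G.map φ) n)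
    exact h1.trans (Subtype.ext hy)
  refine (J.isoRightDerivedObj (torsionFunctor a) n).toLinearEquiv.injective ?_
  have h1 := congrArg (fun f => f.hom x) key
  refine h1.trans ?_
  have h2 := congrArg (fun f => f.hom z) (HomologicalComplex.homologyπ_naturality (G.map φ) n)
  change (HomologicalComplex.homologyMap (G.map φ) n).hom
    ((J.isoRightDerivedObj (torsionFunctor a) n).hom.hom x) =
      (J.isoRightDerivedObj (torsionFunctor a) n).hom.hom x
  rw [← hz]
  exact h2.trans (congrArg (K.homologyπ n).hom hz')

end FiniteSupport

open TensorProduct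

section Theta

variable {R : Type u} [CommRing R] (S : Submonoid R) (a : Ideal R) (n : ℕ)

/-- Local cohomology of the localization of a module. -/
abbrev locLC (M : Type u) [AddCommGroup M] [Module R M] : Type u := lc a n (LocalizedModule S M)

variable {M N P : Type u} [AddCommGroup M] [Module R M] [AddCommGroup N] [Module R N]
  [AddCommGroup P] [Module R P]

/-- The map induced on local cohomology of localizations. -/
noncomputable def locLCMap : (M →ₗ[R] N) →ₗ[R] (locLC S a n M →ₗ[R] locLC S a n N) :=
  lcMapₗ a n ∘ₗ locMap S

lemma locLCMap_id : locLCMap S a n (LinearMap.id : M →ₗ[R] M) = LinearMap.id := by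
  change lcMap a n (locMap S LinearMap.id) = _
  rw [locMap_id, lcMap_id]

lemma locLCMap_comp (g : N →ₗ[R] P) (f : M →ₗ[R] N) :
    locLCMap S a n (g ∘ₗ f) = locLCMap S a n g ∘ₗ locLCMap S a n f := by
  change lcMap a n (locMap S (g ∘ₗ f)) = _
  rw [locMap_comp, lcMap_comp]
  rfl

lemma locLCMap_comp_apply (g : N →ₗ[R] P) (f : M →ₗ[R] N) (x : locLC S a n M) :
    locLCMap S a n (g ∘ₗ f) x = locLCMap S a n g (locLCMap S a n f x) := by
  rw [locLCMap_comp, LinearMap.comp_apply]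

variable (M) in
/-- The comparison map `F(R) ⊗ M → F(M)` for the functor `F = H^n_a(S⁻¹ -)`. -/
noncomputable def theta : locLC S a n R ⊗[R] M →ₗ[R] locLC S a n M :=
  TensorProduct.lift (locLCMap S a n ∘ₗ (LinearMap.lsmul R M).flip).flip

lemma theta_tmul (x : locLC S a n R) (m : M) :
    theta S a n M (x ⊗ₜ m) = locLCMap S a n ((LinearMap.lsmul R M).flip m) x := rfl

lemma theta_naturality (f : M →ₗ[R] N) (t : locLC S a n R ⊗[R] M) :
    locLCMap S a n f (theta S a n M t) = theta S a n N (f.lTensor _ t) := by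
  induction t with
  | zero => simp only [map_zero]
  | add x y hx hy => rw [map_add, map_add, hx, hy, map_add, map_add]
  | tmul x m =>
    rw [LinearMap.lTensor_tmul, theta_tmul, theta_tmul, ← locLCMap_comp_apply]
    congr 2
    ext
    simp

lemma theta_ring (t : locLC S a n R ⊗[R] R) : theta S a n R t = TensorProduct.rid R _ t := by
  induction t with
  | zero => simp only [map_zero]
  | add x y hx hy => rw [map_add, hx, hy, map_add]
  | tmul x m =>
    have : (LinearMap.lsmul R R).flip m = m • LinearMap.id := by
      ext; simp
    rw [theta_tmul, TensorProduct.rid_tmul, this, map_smul, locLCMap_id]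
    rfl

lemma theta_bijective_finsupp [IsNoetherianRing R] (T : Type u) :
    Function.Bijective (theta S a n (T →₀ R)) := by
  classical
  constructor
  · rw [injective_iff_map_eq_zero]
    intro t ht
    refine (finsuppScalarRight R R (locLC S a n R) T).map_eq_zero_iff.1 (Finsupp.ext fun i => ?_)
    rw [finsuppScalarRight_apply]
    change TensorProduct.rid R _ _ = 0
    rw [← theta_ring, ← theta_naturality, ht, map_zero]
  · intro x
    obtain ⟨E, hE⟩ := exists_finsuppProj_fixed S a n T R x
    refine ⟨∑ t ∈ E, locLCMap S a n (Finsupp.lapply t) x ⊗ₜ Finsupp.single t 1, ?_⟩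
    have h1 : locLCMap S a n (finsuppProj E R) x = x := hE
    rw [finsuppProj, map_sum, LinearMap.sum_apply] at h1
    conv_rhs => rw [← h1]
    rw [map_sum]
    refine Finset.sum_congr rfl fun t _ => ?_
    rw [theta_tmul, locLCMap_comp_apply]
    congr 2
    ext
    simp

theorem theta_bijective [IsNoetherianRing R] [hM : Module.Projective R M] :
    Function.Bijective (theta S a n M) := by
  obtain ⟨s, hs⟩ := hM.out
  have hs' : Finsupp.linearCombination R id ∘ₗ s = LinearMap.id := LinearMap.ext hs
  constructor
  · rw [injective_iff_map_eq_zero]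
    intro t ht
    have h1 : s.lTensor (locLC S a n R) t = 0 := (theta_bijective_finsupp S a n M).1 (by
      rw [← theta_naturality, ht, map_zero, map_zero])
    have h2 := LinearMap.lTensor_comp_apply (locLC S a n R) (Finsupp.linearCombination R id) s t
    rwa [hs', LinearMap.lTensor_id, LinearMap.id_apply, h1, map_zero] at h2
  · intro x
    obtain ⟨t, ht⟩ := (theta_bijective_finsupp S a n M).2 (locLCMap S a n s x)
    refine ⟨(Finsupp.linearCombination R id).lTensor _ t, ?_⟩
    rw [← theta_naturality, ht, ← locLCMap_comp_apply, hs', locLCMap_id]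
    rfl

lemma locLC_subsingleton_of_projective [IsNoetherianRing R] [Module.Projective R M]
    [Subsingleton (locLC S a n R)] : Subsingleton (locLC S a n M) := by
  have : Subsingleton (locLC S a n R ⊗[R] M) := inferInstance
  exact (theta_bijective S a n).2.subsingleton

lemma locLC_longExact {f : M →ₗ[R] N} {g : N →ₗ[R] P} (hf : Function.Injective f)
    (hfg : Function.Exact f g) (hg : Function.Surjective g) :
    Function.Exact (locLCMap S a n f) (locLCMap S a n g) ∧
    ∃ δ : locLC S a n P →ₗ[R] locLC S a (n + 1) M, Function.Exact (locLCMap S a n g) δ ∧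
      Function.Exact δ (locLCMap S a (n + 1) f) :=
  lc_longExact a (LocalizedModule.map_injective S f hf) (LocalizedModule.map_exact S f g hfg)
    (LocalizedModule.map_surjective S g hg) n

/-- Top local cohomology is right exact. -/
theorem locLC_rightExact (hvan : ∀ (M : Type u) [AddCommGroup M] [Module R M],
    Subsingleton (locLC S a (n + 1) M)) {f : M →ₗ[R] N} {g : N →ₗ[R] P}
    (hfg : Function.Exact f g) (hg : Function.Surjective g) :
    Function.Exact (locLCMap S a n f) (locLCMap S a n g) ∧
      Function.Surjective (locLCMap S a n g) := by
  have hsurj : ∀ {M N : Type u} [AddCommGroup M] [Module R M] [AddCommGroup N] [Module R N]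
      (g : M →ₗ[R] N), Function.Surjective g → Function.Surjective (locLCMap S a n g) := by
    intro M N _ _ _ _ g hg x
    obtain ⟨-, δ, h, -⟩ := locLC_longExact S a n (LinearMap.ker g).injective_subtype
      (LinearMap.exact_subtype_ker_map g) hg
    exact (h x).1 ((hvan _).elim _ _)
  refine ⟨?_, hsurj g hg⟩
  let f' : M →ₗ[R] LinearMap.ker g := f.codRestrict _ fun x => (hfg _).2 ⟨x, rfl⟩
  have hf' : Function.Surjective f' := fun y => by
    obtain ⟨x, hx⟩ := (hfg _).1 y.2
    exact ⟨x, Subtype.ext hx⟩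
  have hff' : f = (LinearMap.ker g).subtype ∘ₗ f' := rfl
  have h := (locLC_longExact S a n (LinearMap.ker g).injective_subtype
      (LinearMap.exact_subtype_ker_map g) hg).1
  intro y
  rw [h y, hff', locLCMap_comp]
  constructor
  · rintro ⟨z, rfl⟩
    obtain ⟨x, rfl⟩ := hsurj f' hf' z
    exact ⟨x, rfl⟩
  · rintro ⟨x, rfl⟩
    exact ⟨_, rfl⟩

lemma lcMap_zero_injective {f : M →ₗ[R] N} (hf : Function.Injective f) :
    Function.Injective (lcMap a 0 f) := fun x y h => (lcZero a).injective (Subtype.ext (hf (by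
  rw [← lcZero_lcMap, ← lcZero_lcMap, h])))

/-- Dimension shifting below the top degree, in all integral degrees. -/
lemma nonempty_localCohomologyModule_shift (h : ℕ) {f : M →ₗ[R] N} {g : N →ₗ[R] P}
    (hf : Function.Injective f) (hfg : Function.Exact f g) (hg : Function.Surjective g)
    (hN : ∀ i < h, Subsingleton (lc a i N)) (i : ℤ) (hi : i + 1 < h) :
    Nonempty (localCohomologyModule a i (ModuleCat.of R P) ≅
      localCohomologyModule a (i + 1) (ModuleCat.of R M)) := by
  match i with
  | Int.ofNat n =>
    have := hN n (by simp at hi; omega)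
    have := hN (n + 1) (by simp at hi; omega)
    obtain ⟨e⟩ := lc_shift a hf hfg hg n
    exact ⟨e.toModuleIso⟩
  | Int.negSucc 0 =>
    have h1 := hN 0 (by simp at hi; omega)
    have : Subsingleton (lc a 0 M) := (lcMap_zero_injective a hf).subsingleton
    exact ⟨(show PUnit.{u + 1} ≃ₗ[R] lc a 0 M from
      ⟨0, 0, fun _ => rfl, fun _ => Subsingleton.elim _ _⟩).toModuleIso⟩
  | Int.negSucc (n + 1) => exact ⟨Iso.refl (ModuleCat.of R PUnit)⟩

/-- The degree just below the top is the kernel of the map in the top degree. -/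
lemma nonempty_localCohomologyModule_ker (h : ℕ) {f : M →ₗ[R] N} {g : N →ₗ[R] P}
    (hf : Function.Injective f) (hfg : Function.Exact f g) (hg : Function.Surjective g)
    (hN : ∀ i < h, Subsingleton (lc a i N)) (i : ℤ) (hi : i + 1 = h) :
    Nonempty (localCohomologyModule a i (ModuleCat.of R P) ≅
      ModuleCat.of R (LinearMap.ker (lcMap a h f))) := by
  match i with
  | Int.ofNat n =>
    obtain rfl : n + 1 = h := by simp at hi; omega
    have := hN n (by omega)
    obtain ⟨-, δ, h₁, h₂⟩ := lc_longExact a hf hfg hg n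
    have hδ : Function.Injective δ := by
      rw [injective_iff_map_eq_zero]
      intro x hx
      obtain ⟨y, rfl⟩ := (h₁ x).1 hx
      rw [Subsingleton.elim y 0, map_zero]
    exact ⟨((LinearEquiv.ofInjective δ hδ).trans
      (LinearEquiv.ofEq _ _ (LinearMap.exact_iff.1 h₂).symm)).toModuleIso⟩
  | Int.negSucc 0 =>
    obtain rfl : h = 0 := by simp at hi; omega
    have : Subsingleton (LinearMap.ker (lcMap a 0 f)) := by
      rw [LinearMap.ker_eq_bot.2 (lcMap_zero_injective a hf)]
      infer_instance
    exact ⟨(show PUnit.{u + 1} ≃ₗ[R] LinearMap.ker (lcMap a 0 f) from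
      ⟨0, 0, fun _ => rfl, fun _ => Subsingleton.elim _ _⟩).toModuleIso⟩
  | Int.negSucc (n + 1) => exact absurd hi (by omega)

end Theta

section Comparison

variable {R : Type u} [CommRing R]

/-- Homology of a short complex, when the cokernel of its first map is known. -/
lemma nonempty_homology_iso_ker (Z : ShortComplex (ModuleCat.{u} R)) {V W : Type u} [AddCommGroup V]
    [Module R V] [AddCommGroup W] [Module R W] (q : Z.X₂ →ₗ[R] V) (hq : Function.Surjective q)
    (hfq : Function.Exact Z.f.hom q) (i : V →ₗ[R] W)
    (hi : ∀ x, i (q x) = 0 ↔ Z.g.hom x = 0) :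
    Nonempty (Z.homology ≅ ModuleCat.of R (LinearMap.ker i)) := by
  let φ : LinearMap.ker Z.g.hom →ₗ[R] LinearMap.ker i :=
    LinearMap.restrict q fun x hx => (hi x).2 hx
  have hφ : Function.Surjective φ := fun y => by
    obtain ⟨x, hx⟩ := hq y.1
    exact ⟨⟨x, (hi x).1 (by rw [hx]; exact y.2)⟩, Subtype.ext hx⟩
  have hker : LinearMap.range Z.moduleCatToCycles = LinearMap.ker φ := by
    ext x
    constructor
    · rintro ⟨y, rfl⟩
      exact Subtype.ext ((hfq _).2 ⟨y, rfl⟩)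
    · intro hx
      obtain ⟨y, hy⟩ := (hfq x.1).1 (congrArg Subtype.val hx)
      exact ⟨y, Subtype.ext hy⟩
  exact ⟨Z.moduleCatHomologyIso ≪≫ ((Submodule.quotEquivOfEq _ _ hker).trans
    (φ.quotKerEquivOfSurjective hφ)).toModuleIso⟩

variable (S : Submonoid R) (a : Ideal R)

/-- The functor `H^n_a(S⁻¹ -)`. -/
noncomputable def locLCFunctor (n : ℕ) : ModuleCat.{u} R ⥤ ModuleCat.{u} R :=
  locFunctor S ⋙ (torsionFunctor a).rightDerived n

instance (n : ℕ) : (locLCFunctor S a n).Additive := by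
  unfold locLCFunctor; infer_instance

/-- `theta` as an isomorphism of complexes on a complex of projective modules. -/
lemma nonempty_thetaComplex_iso [IsNoetherianRing R] (n : ℕ) (C : ChainComplex (ModuleCat.{u} R) ℕ)
    (hC : ∀ i, Module.Projective R (C.X i)) :
    Nonempty ((((MonoidalCategory.tensoringLeft (ModuleCat.{u} R)).obj
      (ModuleCat.of R (locLC S a n R))).mapHomologicalComplex _).obj C ≅
      ((locLCFunctor S a n).mapHomologicalComplex _).obj C) :=
  ⟨HomologicalComplex.Hom.isoOfComponents
    (fun i => (LinearEquiv.ofBijective (theta S a n (C.X i)) (theta_bijective S a n)).toModuleIso)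
    (fun i j _ => ModuleCat.hom_ext (LinearMap.ext fun t =>
      theta_naturality S a n (C.d i j).hom t))⟩

variable {h : ℕ} (hvan : ∀ (M : Type u) [AddCommGroup M] [Module R M],
    Subsingleton (locLC S a (h + 1) M)) (hring : ∀ i < h, Subsingleton (locLC S a i R))

include hvan hring in
/-- `Tor` against the top local cohomology of `S⁻¹R` computes local cohomology. -/
theorem nonempty_tor_iso_localCohomologyModule [IsNoetherianRing R] (M : Type u) [AddCommGroup M]
    [Module R M] (k : ℕ) :
    Nonempty (((Tor (ModuleCat.{u} R) k).obj (ModuleCat.of R (locLC S a h R))).obj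
      (ModuleCat.of R M) ≅
        localCohomologyModule a (h - k) (ModuleCat.of R (LocalizedModule S M))) := by
  let P := ProjectiveResolution.of (ModuleCat.of R M)
  let C := P.complex
  have hC : ∀ i, Module.Projective R (C.X i) := fun i =>
    (IsProjective.iff_projective (C.X i)).2 (P.projective i)
  obtain ⟨e₁⟩ := nonempty_thetaComplex_iso S a h C hC
  let K := ((locLCFunctor S a h).mapHomologicalComplex _).obj C
  have e₂ : ((Tor (ModuleCat.{u} R) k).obj (ModuleCat.of R (locLC S a h R))).obj
      (ModuleCat.of R M) ≅ K.homology k := P.isoLeftDerivedObj _ k ≪≫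
    (HomologicalComplex.homologyFunctor _ _ k).mapIso e₁
  suffices Nonempty (K.homology k ≅
      localCohomologyModule a (h - k) (ModuleCat.of R (LocalizedModule S M))) from
    this.map fun e => e₂ ≪≫ e
  let d : ∀ j, C.X (j + 1) →ₗ[R] C.X j := fun j => (C.d (j + 1) j).hom
  let Q : ℕ → Type u := fun j => C.X j ⧸ LinearMap.range (d j)
  let q : ∀ j, C.X j →ₗ[R] Q j := fun j => (LinearMap.range (d j)).mkQ
  have hq : ∀ j, Function.Surjective (q j) := fun j => Submodule.mkQ_surjective _
  have hdq : ∀ j, Function.Exact (d j) (q j) := fun j => LinearMap.exact_map_mkQ_range (d j)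
  have hdd : ∀ j, Function.Exact (d (j + 1)) (d j) := fun j =>
    (ShortComplex.ShortExact.moduleCat_exact_iff_function_exact _).1 (P.exact_succ j)
  let i : ∀ j, Q (j + 1) →ₗ[R] C.X j := fun j => (LinearMap.range (d (j + 1))).liftQ (d j)
    (LinearMap.exact_iff.1 (hdd j)).ge
  have hiq : ∀ j, i j ∘ₗ q (j + 1) = d j := fun j => Submodule.liftQ_mkQ _ _ _
  have hi : ∀ j, Function.Injective (i j) := fun j => LinearMap.ker_eq_bot.1
    (Submodule.ker_liftQ_eq_bot _ _ _ (LinearMap.exact_iff.1 (hdd j)).le)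
  have hiq' : ∀ j, Function.Exact (i j) (q j) := fun j => by
    rw [LinearMap.exact_iff, LinearMap.exact_iff.1 (hdq j), ← hiq j,
      LinearMap.range_comp_of_range_eq_top _ (LinearMap.range_eq_top.2 (hq _))]
  have hacyc : ∀ j, ∀ m < h, Subsingleton (lc a m (LocalizedModule S (C.X j))) := fun j m hm => by
    have := hring m hm
    exact locLC_subsingleton_of_projective S a m (M := C.X j)
  have hright := fun j => locLC_rightExact S a h hvan (hdq j) (hq j)
  obtain ⟨eM⟩ : Nonempty (Q 0 ≃ₗ[R] M) := by
    let π₀ : C.X 0 ⟶ ModuleCat.of R M := P.π.f 0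
    have hπ : Function.Surjective π₀.hom :=
      (ModuleCat.epi_iff_surjective π₀).1 (inferInstanceAs (Epi (P.π.f 0)))
    have hex : Function.Exact (d 0) π₀.hom :=
      (ShortComplex.ShortExact.moduleCat_exact_iff_function_exact _).1 P.exact₀
    exact ⟨(Submodule.quotEquivOfEq _ _ (LinearMap.exact_iff.1 hex).symm).trans
      (π₀.hom.quotKerEquivOfSurjective hπ)⟩
  let eM' : LocalizedModule S (Q 0) ≃ₗ[R] LocalizedModule S M :=
    LinearEquiv.ofLinearMap (locMap S eM.toLinearMap) (locMap S eM.symm.toLinearMap)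
      (by rw [← locMap_comp, LinearEquiv.comp_symm, locMap_id])
      (by rw [← locMap_comp, LinearEquiv.symm_comp, locMap_id])
  have hcongr : ∀ m : ℤ, Nonempty (localCohomologyModule a m (ModuleCat.of R
      (LocalizedModule S (Q 0))) ≅ localCohomologyModule a m (ModuleCat.of R
      (LocalizedModule S M))) := fun m => by
    cases m with
    | ofNat m => exact ⟨(lcCongr a m eM').toModuleIso⟩
    | negSucc m => exact ⟨Iso.refl (ModuleCat.of R PUnit)⟩
  cases k with
  | zero =>
    have hZ := nonempty_homology_iso_ker (K.sc' 1 0 0) (locLCMap S a h (q 0)) (hright 0).2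
      (hright 0).1 (0 : _ →ₗ[R] R) fun x => by
        have : (K.sc' 1 0 0).g = 0 := K.shape _ _ (by simp)
        rw [this]
        simp
    obtain ⟨e₃⟩ := hZ
    obtain ⟨e₄⟩ := hcongr h
    have e₅ : K.homology 0 ≅ (K.sc' 1 0 0).homology := K.homologyIsoSc' 1 0 0 (by simp) (by simp)
    have e₆ : ModuleCat.of R (LinearMap.ker (0 : locLC S a h (Q 0) →ₗ[R] R)) ≅
        localCohomologyModule a h (ModuleCat.of R (LocalizedModule S (Q 0))) :=
      ((LinearEquiv.ofEq _ _ LinearMap.ker_zero).trans Submodule.topEquiv).toModuleIso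
    rw [Nat.cast_zero, sub_zero]
    exact ⟨e₅ ≪≫ e₃ ≪≫ e₆ ≪≫ e₄⟩
  | succ k =>
    have hx : ∀ x : locLC S a h (C.X (k + 1)),
        locLCMap S a h (i k) (locLCMap S a h (q (k + 1)) x) = locLCMap S a h (d k) x :=
      fun x => by rw [← locLCMap_comp_apply, hiq]
    obtain ⟨e₃⟩ := nonempty_homology_iso_ker (K.sc' (k + 2) (k + 1) k) (locLCMap S a h (q (k + 1)))
      (hright (k + 1)).2 (hright (k + 1)).1 (locLCMap S a h (i k))
      fun x => iff_of_eq (congrArg (· = 0) (hx x))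
    have e₅ : K.homology (k + 1) ≅ (K.sc' (k + 2) (k + 1) k).homology :=
      K.homologyIsoSc' (k + 2) (k + 1) k (by simp) (by simp)
    have hchain : ∀ j, j ≤ k → Nonempty (localCohomologyModule a (h - (k + 1 : ℕ))
        (ModuleCat.of R (LocalizedModule S (Q 0))) ≅ localCohomologyModule a (h - (k + 1 : ℕ) + j)
        (ModuleCat.of R (LocalizedModule S (Q j)))) := by
      intro j
      induction j with
      | zero =>
        intro _
        rw [Nat.cast_zero, add_zero]
        exact ⟨Iso.refl _⟩
      | succ j ih =>
        intro hj
        obtain ⟨e⟩ := ih (by omega)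
        obtain ⟨e'⟩ := nonempty_localCohomologyModule_shift a h
          (LocalizedModule.map_injective S (i j) (hi j)) (LocalizedModule.map_exact S _ _ (hiq' j))
          (LocalizedModule.map_surjective S (q j) (hq j)) (hacyc j) (h - (k + 1 : ℕ) + j)
          (by push_cast; omega)
        rw [Nat.cast_succ j, ← add_assoc]
        exact ⟨e ≪≫ e'⟩
    obtain ⟨e₆⟩ := hchain k le_rfl
    obtain ⟨e₇⟩ := nonempty_localCohomologyModule_ker a h
      (LocalizedModule.map_injective S (i k) (hi k)) (LocalizedModule.map_exact S _ _ (hiq' k))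
      (LocalizedModule.map_surjective S (q k) (hq k)) (hacyc k) (h - (k + 1 : ℕ) + k)
      (by push_cast; omega)
    obtain ⟨e₄⟩ := hcongr (h - (k + 1 : ℕ))
    exact ⟨e₅ ≪≫ e₃ ≪≫ e₇.symm ≪≫ e₆.symm ≪≫ e₄⟩

end Comparison

end LocalCohomologyTor

theorem mainTheorem6 (R : Type u) [CommRing R] (hR : LocalCohomologyTor.IsCohenMacaulay R)
    (D : Type u) [AddCommGroup D] [Module R D] (hD : LocalCohomologyTor.IsDualizing R D)
    (p : Ideal R) [p.IsPrime] (h : ℕ) (hh : p.height = h)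
    (E : Type u) [AddCommGroup E] [Module R E] (ι : (R ⧸ p) →ₗ[R] E)
    (hE : LocalCohomologyTor.IsInjectiveHull R ι)
    (M : Type u) [AddCommGroup M] [Module R M] (k : ℤ) :
    Nonempty (LocalCohomologyTor.torModule k (ModuleCat.of R (D →ₗ[R] E)) (ModuleCat.of R M) ≅
      LocalCohomologyTor.localCohomologyModule p (h - k)
        (ModuleCat.of R (LocalizedModule p.primeCompl M))) ∧
    Nonempty (LocalCohomologyTor.localCohomologyModule p (h - k)
        (ModuleCat.of R (LocalizedModule p.primeCompl M)) ≅
      (ModuleCat.restrictScalars (algebraMap R (Localization.AtPrime p))).obj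
        (LocalCohomologyTor.localCohomologyModule
          (p.map (algebraMap R (Localization.AtPrime p))) (h - k)
          (ModuleCat.of (Localization.AtPrime p) (LocalizedModule p.primeCompl M)))) := by
  have := hR.noetherian
  have : Module.Flat R (Localization.AtPrime p) := IsLocalization.flat _ p.primeCompl
  refine ⟨?_, LocalCohomologyTor.nonempty_localCohomologyModule_restrictScalars_iso p _ _⟩
  have hvan : ∀ i, h < i → ∀ (M : Type u) [AddCommGroup M] [Module R M],
      Subsingleton (LocalCohomologyTor.locLC p.primeCompl p i M) := fun i hi M _ _ =>
    LocalCohomologyTor.lc_subsingleton_of_height_lt hR p hh i hi _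
  obtain ⟨e⟩ := LocalCohomologyTor.nonempty_lc_equiv_hom hR p hh hD hE
  match k with
  | Int.ofNat k =>
    obtain ⟨e'⟩ := LocalCohomologyTor.nonempty_tor_iso_localCohomologyModule p.primeCompl p
      (hvan (h + 1) h.lt_succ_self)
      (fun i hi => LocalCohomologyTor.lc_subsingleton_of_lt_height hR p hh i hi) M k
    exact ⟨((Tor (ModuleCat.{u} R) k).mapIso e.toModuleIso.symm).app (ModuleCat.of R M) ≪≫ e'⟩
  | Int.negSucc k =>
    have hk : (h : ℤ) - Int.negSucc k = Int.ofNat (h + (k + 1)) := by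
      rw [Int.negSucc_eq]; simp; omega
    rw [hk]
    have := hvan (h + (k + 1)) (by omega) M
    exact ⟨(show PUnit.{u + 1} ≃ₗ[R] LocalCohomologyTor.locLC p.primeCompl p (h + (k + 1)) M from
      ⟨0, 0, fun _ => rfl, fun _ => Subsingleton.elim _ _⟩).toModuleIso⟩
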